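/- Let $K$ be a field of characteristic zero (for example $\mathbb{Q}(t)$ or $\mathbb{Q}(q,t)$), let $t\in K$, and let $\Lambda=K[p_1,p_2,\dots]$ be the ring of symmetric functions over $K$, with Hall scalar product $\langle p_\lambda,p_\mu\rangle=\delta_{\lambda\mu}z_\lambda$. Write $f^\perp$ for the adjoint of multiplication by $f$, $h_i$ for the complete symmetric functions ($h_i=0$ for $i<0$), and $f\mapsto f[X(t-1)]$ for the algebra endomorphism with $p_k\mapsto(t^k-1)p_k$. For $\ell\in\mathbb{Z}$ let $$B_\ell=\sum_{i\ge 0}h_{i+\ell}\,h_i[X(t-1)]^\perp,$$ and for an integer vector $v=(v_1,\dots,v_L)$ (zero entries count in the length $L$) let $$B_v=\prod_{1\le i<j\le L}(1-t\,e_{ij})\;B_{v_1}\cdots B_{v_L},$$ where the formal raising operator $e_{ij}$ increases the $i$-th index by $1$ and decreases the $j$-th index by $1$. Let $a,r,m$ be nonnegative integers and let $\nu=(\nu_1\ge\dots\ge\nu_n\ge 0)$ be a partition with $n\le r$ entries. Then, as operators on $\Lambda$, $$B_{a^{r+m}}\,B_\nu=\sum_{\mu}(-t)^{|\mu|}\,B_{a^r+\mu}\,B_{(a^m-(\mu')^R,\;\nu)},$$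 where $\mu$ runs over all partitions with at most $r$ nonzero parts, all at most $m$. Here $a^r+\mu$ is the vector $(a+\mu_1,\dots,a+\mu_r)$ of length $r$, $\mu'$ is the conjugate partition, and $(a^m-(\mu')^R,\nu)$ is the vector $(a-\mu'_m,\dots,a-\mu'_1,\nu_1,\dots,\nu_n)$ of length $m+n$; its first $m$ entries may be negative. -/

import Mathlib

noncomputable section

namespace SymFn

variable (K : Type*) [Field K]

/-- The ring `Λ` of symmetric functions over a field `K` of characteristic zero, as the polynomial
ring in the power sums `p₁, p₂, …`; the variable `X k` is `p k`. -/
abbrev Lam : Type _ := MvPolynomial ℕ+ K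

/-- Specialization of a symmetric function to finitely many variables `x_i`, `i : σ`:
`p k` becomes `∑ i, x_i ^ k`. -/
def toVars (σ : Type*) [Fintype σ] : Lam K →ₐ[K] MvPolynomial σ K :=
  MvPolynomial.aeval fun k : ℕ+ => MvPolynomial.psum σ K (k : ℕ)

/-- The complete symmetric functions `h₀ = 1, h₁, h₂, …`, through
`n h_n = ∑_{i=1}^{n} p_i h_{n-i}`; see `toVars_h` for their description as sums of monomials. -/
def h : ℕ → Lam K
  | 0 => 1
  | n + 1 => MvPolynomial.C (((n + 1 : ℕ) : K)⁻¹) *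
      ∑ i : Fin (n + 1), MvPolynomial.X (Nat.succPNat i) * h (n - i)

/-- `h_r` for an integer `r`, with `h_r = 0` for `r < 0`. This is also the Schur function `s_r`. -/
def hInt (r : ℤ) : Lam K := if 0 ≤ r then h K r.toNat else 0

variable {K}

/-- The number `z_λ = ∏_k k^{m_k} m_k!` of the partition with `m k` parts equal to `k`. -/
def z (m : ℕ+ →₀ ℕ) : K := m.prod fun k e => ((k : ℕ) : K) ^ e * (e.factorial : K)

variable (K) in
/-- The Hall scalar product, `⟨p_λ, p_μ⟩ = δ_{λμ} z_λ`. -/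
def hall : Lam K →ₗ[K] Lam K →ₗ[K] K :=
  (MvPolynomial.basisMonomials ℕ+ K).constr K fun m =>
    (MvPolynomial.basisMonomials ℕ+ K).constr K fun n => if m = n then z m else 0

/-- The adjoint of multiplication by `p_λ`, where `λ` has `n k` parts equal to `k`. -/
def perpMon (n : ℕ+ →₀ ℕ) : Lam K →ₗ[K] Lam K :=
  (MvPolynomial.basisMonomials ℕ+ K).constr K fun m =>
    if n ≤ m then MvPolynomial.monomial (m - n) (z m / z (m - n)) else 0

/-- The operator `f^⊥`, adjoint to multiplication by `f`; see `hall_perp` and `perp_unique`. -/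
def perp : Lam K →ₗ[K] Module.End K (Lam K) :=
  (MvPolynomial.basisMonomials ℕ+ K).constr K perpMon

/-- The plethysm `f ↦ f[X(t-1)]`: the power sum `p k` becomes `(t ^ k - 1) p k`. -/
def pleth (t : K) : Lam K →ₐ[K] Lam K :=
  MvPolynomial.aeval fun k : ℕ+ => MvPolynomial.C (t ^ (k : ℕ) - 1) * MvPolynomial.X k

/-! ### Checks on the definitions -/

@[simp] lemma hall_monomial (m n : ℕ+ →₀ ℕ) (c d : K) :
    hall K (MvPolynomial.monomial m c) (MvPolynomial.monomial n d) =
      if m = n then c * d * z m else 0 := by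
  have h1 : ∀ (m : ℕ+ →₀ ℕ) (c : K), MvPolynomial.monomial m c =
      c • MvPolynomial.basisMonomials ℕ+ K m := by
    intro m c; simp [MvPolynomial.smul_monomial]
  rw [h1, h1]
  simp only [map_smul, LinearMap.smul_apply, hall, Module.Basis.constr_basis]
  split_ifs
  · simp only [smul_eq_mul]; ring
  · simp

@[simp] lemma perpMon_monomial (n m : ℕ+ →₀ ℕ) (c : K) :
    perpMon n (MvPolynomial.monomial m c) =
      if n ≤ m then MvPolynomial.monomial (m - n) (c * (z m / z (m - n))) else 0 := by
  have h1 : MvPolynomial.monomial m c = c • MvPolynomial.basisMonomials ℕ+ K m := by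
    simp [MvPolynomial.smul_monomial]
  rw [h1]
  simp only [map_smul, perpMon, Module.Basis.constr_basis]
  split_ifs <;> simp [MvPolynomial.smul_monomial]

@[simp] lemma perp_monomial (n : ℕ+ →₀ ℕ) (c : K) :
    perp (MvPolynomial.monomial n c) = c • perpMon n := by
  have h1 : MvPolynomial.monomial n c = c • MvPolynomial.basisMonomials ℕ+ K n := by
    simp [MvPolynomial.smul_monomial]
  rw [h1]
  simp only [map_smul, perp, Module.Basis.constr_basis]

lemma z_ne_zero [CharZero K] (m : ℕ+ →₀ ℕ) : (z m : K) ≠ 0 := by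
  refine Finset.prod_ne_zero_iff.2 fun k _ => mul_ne_zero (pow_ne_zero _ ?_) ?_
  · exact_mod_cast k.ne_zero
  · exact_mod_cast Nat.factorial_ne_zero _

/-- `f^⊥` is adjoint to multiplication by `f`. -/
theorem hall_perp [CharZero K] (f g q : Lam K) : hall K (perp f g) q = hall K g (f * q) := by
  induction f using MvPolynomial.induction_on' with
  | add f₁ f₂ h₁ h₂ => simp [add_mul, h₁, h₂]
  | monomial n c =>
    induction g using MvPolynomial.induction_on' with
    | add g₁ g₂ h₁ h₂ => simp only [map_add, LinearMap.add_apply, h₁, h₂]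
    | monomial m d =>
      induction q using MvPolynomial.induction_on' with
      | add q₁ q₂ h₁ h₂ => simp only [map_add, mul_add, h₁, h₂]
      | monomial l e =>
        simp only [perp_monomial, LinearMap.smul_apply, perpMon_monomial, map_smul,
          MvPolynomial.monomial_mul, hall_monomial]
        by_cases hnm : n ≤ m
        · have h2 : m - n = l ↔ m = n + l := by
            constructor
            · rintro rfl; exact (add_tsub_cancel_of_le hnm).symm
            · rintro rfl; exact add_tsub_cancel_left n l
          simp only [hnm, if_true, hall_monomial, h2]
          split_ifs with h3
          · have := z_ne_zero (K := K) (m - n)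
            simp only [smul_eq_mul]
            field_simp
          · simp
        · have h3 : m ≠ n + l := by
            rintro rfl; exact hnm le_self_add
          simp [hnm, h3]

/-- The Hall scalar product is nondegenerate. -/
theorem hall_nondeg [CharZero K] {g g' : Lam K} (H : ∀ q, hall K g q = hall K g' q) : g = g' := by
  have key : ∀ (g : Lam K) (m : ℕ+ →₀ ℕ),
      hall K g (MvPolynomial.monomial m 1) = MvPolynomial.coeff m g * z m := by
    intro g m
    induction g using MvPolynomial.induction_on' with
    | add g₁ g₂ h₁ h₂ => simp [h₁, h₂, add_mul]
    | monomial n c =>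
      simp only [hall_monomial, MvPolynomial.coeff_monomial]
      split_ifs with h1
      · subst h1; ring
      · simp
  ext m
  have := H (MvPolynomial.monomial m 1)
  rw [key, key] at this
  exact mul_right_cancel₀ (z_ne_zero m) this

/-- `f^⊥` is the only adjoint of multiplication by `f`. -/
theorem perp_unique [CharZero K] (f : Lam K) (A : Lam K → Lam K)
    (H : ∀ g q, hall K (A g) q = hall K g (f * q)) (g : Lam K) : A g = perp f g :=
  hall_nondeg fun q => by rw [H, hall_perp]

lemma coeff_hsymm (σ : Type*) [Fintype σ] [DecidableEq σ] (n : ℕ) (d : σ →₀ ℕ) :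
    MvPolynomial.coeff d (MvPolynomial.hsymm σ K n) = if d.degree = n then 1 else 0 := by
  have h0 : ∀ s : Multiset σ, (s.map (MvPolynomial.X (R := K))).prod =
      MvPolynomial.monomial (Multiset.toFinsupp s) 1 := by
    intro s
    induction s using Multiset.induction_on with
    | empty => simp
    | cons a s ih =>
      rw [Multiset.map_cons, Multiset.prod_cons, ih, MvPolynomial.X, MvPolynomial.monomial_mul,
        ← Multiset.singleton_add, map_add, Multiset.toFinsupp_singleton, one_mul]
  have hdeg : ∀ s : Multiset σ, (Multiset.toFinsupp s).degree = Multiset.card s := by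
    intro s
    induction s using Multiset.induction_on with
    | empty => simp
    | cons a s ih =>
      rw [← Multiset.singleton_add, map_add, map_add, ih, Multiset.toFinsupp_singleton]
      simp [add_comm]
  have h1 : MvPolynomial.hsymm σ K n =
      ∑ s : Sym σ n, MvPolynomial.monomial (Multiset.toFinsupp (s : Multiset σ)) 1 :=
    Finset.sum_congr rfl fun s _ => h0 _
  rw [h1, MvPolynomial.coeff_sum]
  simp only [MvPolynomial.coeff_monomial]
  split_ifs with hd
  · have hc : Multiset.card (Finsupp.toMultiset d) = n := by
      rw [← hd, ← hdeg, Finsupp.toMultiset_toFinsupp]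
    refine (Finset.sum_eq_single (⟨Finsupp.toMultiset d, hc⟩ : Sym σ n) ?_ ?_).trans ?_
    · rintro s _ hne
      refine if_neg fun hs => hne (Subtype.ext ?_)
      change s.1 = Finsupp.toMultiset d
      rw [← hs]
      exact (Multiset.toFinsupp_toMultiset s.1).symm
    · exact fun hne => (hne (Finset.mem_univ (α := Sym σ n) _)).elim
    · exact if_pos (Finsupp.toMultiset_toFinsupp d)
  · refine Finset.sum_eq_zero fun s _ => if_neg ?_
    rintro rfl
    exact hd ((hdeg _).trans s.2)

/-- In any finite set of variables, `h_n` is the sum of all monomials of degree `n`. -/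
theorem toVars_h [CharZero K] (σ : Type*) [Fintype σ] [DecidableEq σ] (n : ℕ) :
    toVars K σ (h K n) = MvPolynomial.hsymm σ K n := by
  induction n using Nat.strong_induction_on with
  | _ n ih =>
    cases n with
    | zero => simp [h]
    | succ n =>
      have hn : ((n + 1 : ℕ) : K) ≠ 0 := by exact_mod_cast n.succ_ne_zero
      rw [h, map_mul, map_sum]
      have h1 : ∀ i : Fin (n + 1), toVars K σ (MvPolynomial.X (Nat.succPNat i) * h K (n - i)) =
          ∑ j : σ, MvPolynomial.monomial (Finsupp.single j ((i : ℕ) + 1)) 1 *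
            MvPolynomial.hsymm σ K (n - i) := by
        intro i
        rw [map_mul, ih _ (by omega), ← Finset.sum_mul]
        congr 1
        simp [toVars, MvPolynomial.psum, MvPolynomial.X_pow_eq_monomial]
      simp only [h1]
      ext d
      rw [coeff_hsymm]
      simp only [MvPolynomial.algHom_C, MvPolynomial.algebraMap_eq, MvPolynomial.coeff_C_mul,
        MvPolynomial.coeff_sum, MvPolynomial.coeff_monomial_mul', coeff_hsymm, one_mul]
      have h2 : ∀ (i : Fin (n + 1)) (j : σ),
          (if Finsupp.single j ((i : ℕ) + 1) ≤ d then
            (if (d - Finsupp.single j ((i : ℕ) + 1)).degree = n - i then (1 : K) else 0) else 0) =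
          if d.degree = n + 1 then (if (i : ℕ) < d j then 1 else 0) else 0 := by
        intro i j
        have h0 : Finsupp.single j ((i : ℕ) + 1) ≤ d ↔ (i : ℕ) < d j := by
          rw [Finsupp.single_le_iff, Nat.succ_le_iff]
        by_cases hle : Finsupp.single j ((i : ℕ) + 1) ≤ d
        · have h3 : (d - Finsupp.single j ((i : ℕ) + 1)).degree + (i + 1) = d.degree := by
            conv_rhs => rw [← tsub_add_cancel_of_le hle, map_add, Finsupp.degree_single]
          have h4 : (i : ℕ) < d j := h0.1 hle
          have h5 := i.2
          simp only [hle, if_true, h4]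
          congr 1
          apply propext
          omega
        · have h4 : ¬ (i : ℕ) < d j := fun h5 => hle (h0.2 h5)
          rw [if_neg hle, if_neg h4, ite_self]
      simp only [h2]
      by_cases hd : d.degree = n + 1
      · simp only [hd, if_true]
        rw [Finset.sum_comm]
        have h6 : ∀ j : σ, ∑ i : Fin (n + 1), (if (i : ℕ) < d j then (1 : K) else 0) = d j := by
          intro j
          have h7 : d j ≤ n + 1 := hd ▸ Finsupp.le_degree j d
          rw [Fin.sum_univ_eq_sum_range (fun i => if i < d j then (1 : K) else 0) (n + 1),
            Finset.sum_boole]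
          congr 1
          rw [show (Finset.range (n + 1)).filter (fun i => i < d j) = Finset.range (d j) by
            ext i; simp; omega]
          simp
        simp only [h6]
        rw [← Nat.cast_sum, ← Finsupp.degree_eq_sum, hd]
        exact inv_mul_cancel₀ hn
      · simp [hd]

/-! ### The vertex operators -/

/-- Weight of the variable `p k`, equal to its degree `k`. -/
abbrev wt : ℕ+ → ℕ := fun k => (k : ℕ)

lemma pleth_h_homogeneous (t : K) (n : ℕ) :
    MvPolynomial.IsWeightedHomogeneous wt (pleth t (h K n)) n := by
  induction n using Nat.strong_induction_on with
  | _ n ih =>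
    cases n with
    | zero => simpa [h] using MvPolynomial.isWeightedHomogeneous_one K wt
    | succ n =>
      rw [h, map_mul, map_sum, MvPolynomial.algHom_C, MvPolynomial.algebraMap_eq]
      refine MvPolynomial.IsWeightedHomogeneous.C_mul
        (MvPolynomial.IsWeightedHomogeneous.sum _ _ _ fun i _ => ?_) _
      have h1 := (ih (n - i) (by omega))
      have h2 : MvPolynomial.IsWeightedHomogeneous wt
          (pleth t (MvPolynomial.X (Nat.succPNat i))) ((i : ℕ) + 1) := by
        simp only [pleth, MvPolynomial.aeval_X]
        exact (MvPolynomial.isWeightedHomogeneous_X K wt (Nat.succPNat i)).C_mul _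
      have h3 := h2.mul h1
      rw [map_mul]
      convert h3 using 1
      omega

lemma perp_eq_zero {f g : Lam K} {n : ℕ} (hf : MvPolynomial.IsWeightedHomogeneous wt f n)
    (hg : MvPolynomial.weightedTotalDegree wt g < n) : perp f g = 0 := by
  rw [MvPolynomial.as_sum f, map_sum, LinearMap.sum_apply]
  refine Finset.sum_eq_zero fun a ha => ?_
  rw [perp_monomial, LinearMap.smul_apply]
  conv_lhs => rw [MvPolynomial.as_sum g, map_sum]
  rw [Finset.sum_eq_zero, smul_zero]
  intro b hb
  rw [perpMon_monomial, if_neg]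
  intro hab
  have h1 : Finsupp.weight wt a = n := hf (MvPolynomial.mem_support_iff.1 ha)
  have h2 := MvPolynomial.le_weightedTotalDegree wt hb
  have h3 : Finsupp.weight wt b = Finsupp.weight wt a + Finsupp.weight wt (b - a) := by
    rw [← map_add, add_tsub_cancel_of_le hab]
  omega

/-- For every `g` only finitely many terms of `∑_i s_{i+ℓ} s_i[X(t-1)]^⊥ g` are nonzero. -/
lemma finite_support (t : K) (l : ℤ) (g : Lam K) :
    (Function.support fun i : ℕ => hInt K (i + l) * perp (pleth t (h K i)) g).Finite := by
  refine (Set.finite_Iic (MvPolynomial.weightedTotalDegree wt g)).subset fun i hi => ?_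
  by_contra hlt
  refine hi ?_
  simp only [Set.mem_Iic, not_le] at hlt
  simp only [perp_eq_zero (pleth_h_homogeneous t i) hlt, mul_zero]

/-- The vertex operator `B_ℓ = ∑_{i ≥ 0} s_{i+ℓ}[X] s_i[X(t-1)]^⊥`, for an integer `ℓ`. -/
def B (t : K) (l : ℤ) : Module.End K (Lam K) where
  toFun g := ∑ᶠ i : ℕ, hInt K (i + l) * perp (pleth t (h K i)) g
  map_add' g g' := by
    rw [← finsum_add_distrib (finite_support t l g) (finite_support t l g')]
    simp only [map_add, mul_add]
  map_smul' c g := by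
    rw [RingHom.id_apply, smul_finsum' c (finite_support t l g)]
    simp only [map_smul, mul_smul_comm]

/-- The composition `B_{v_1} ⋯ B_{v_L}`. -/
def Bprod (t : K) {L : ℕ} (v : Fin L → ℤ) : Module.End K (Lam K) :=
  (List.ofFn fun i => B t (v i)).prod

/-- The product `∏_{i<j} (1 - t e_{ij})` of formal raising operators on vectors of length `L`, in
the group algebra of `ℤ^L`; the operator `e_{ij}` adds `1` to entry `i` and subtracts `1` from
entry `j`. -/
def raising (t : K) (L : ℕ) : AddMonoidAlgebra K (Fin L → ℤ) :=
  ∏ ij : Fin L × Fin L with ij.1 < ij.2,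
    (1 - AddMonoidAlgebra.single (Pi.single ij.1 1 - Pi.single ij.2 1) t)

/-- The operator `B_v = ∏_{i<j} (1 - t e_{ij}) B_{v_1} ⋯ B_{v_L}` for an integer vector `v` of
length `L`. Zero entries count: the length of `v` is `L`. -/
def Bvec (t : K) {L : ℕ} (v : Fin L → ℤ) : Module.End K (Lam K) :=
  Finsupp.linearCombination K (fun w : Fin L → ℤ => Bprod t w)
    (raising t L * AddMonoidAlgebra.single v 1).coeff

/-! ### Partitions in a box -/

open Classical in
/-- The partitions with at most `r` nonzero parts, all at most `m`, written as vectors of length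
`r` (padded by zeros). -/
def boxPartitions (r m : ℕ) : Finset (Fin r → ℕ) :=
  (Fintype.piFinset fun _ => Finset.range (m + 1)).filter Antitone

/-- The conjugate `μ'` of a partition `μ` with parts at most `m`, as a vector of length `m`:
`μ'_j` is the number of parts of `μ` that are at least `j`. Indices start at `0`. -/
def conj {r : ℕ} (m : ℕ) (μ : Fin r → ℕ) : Fin m → ℕ :=
  fun j => (Finset.univ.filter fun i => (j : ℕ) < μ i).card

/-- The vector `a^m - (μ')^R`, where `R` reverses the order of the entries. -/
def rectSubConj {r : ℕ} (a m : ℕ) (μ : Fin r → ℕ) : Fin m → ℤ :=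
  fun j => (a : ℤ) - (conj m μ j.rev : ℤ)

end SymFn

end

/-!
Let `e_{ij}` be the raising operators, and let `u`, `v` and `w` be the blocks of positions of `a^r`,
`a^m` and `ν`. The argument never leaves finite sums. It uses only that `B_v` is antisymmetric in the
entries of `v + ρ`, and the expansion `Bvec_append` of the factors `1 - t e_{ij}` between two blocks
as a sum over `0`-`1` matrices, whose row sums are added to the first block and whose column sums
are subtracted from the second.

* Antisymmetry. The generating function of the operators `h_n[X(t-1)]^⊥` is the algebra
  homomorphism `p_k ↦ p_k + (t^k - 1) u^k` (`perp_pleth_h`). It sends the generating function `H(s)`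
  of the `h_k` to `(1 - us) / (1 - tus) H(s)` (`shift_h_succ`), whence the quadratic relation
  `B_mul_B_sub`: `B_{(a,b)}` changes its sign under `(a, b) ↦ (b - 1, a + 1)`. Expanding the factors
  between a pair of neighbouring positions and the other positions carries this over to vectors of
  any length (`isAntisymm_Bvec`).

* The right-hand side. By the dual Cauchy identity `dual_cauchy` the sum over `μ` is the expansion
  of `∏_{i ∈ u, j ∈ v} (1 - t e_{ij})` applied to `B_{a^r} B_{(a^m, ν)}`. The identity is proved by
  writing the Vandermonde determinant in two sets of variables as the product of the two smaller
  ones and of the differences between the sets; the surviving monomials belong to shuffles, and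
  these correspond to the partitions in the `r × m` box (`exists_shuffle`, `shuffle_natAdd`).

* The left-hand side. The factors `1 - t e_{ij}` with `i` in `v` and `j` in `w` may be inserted at
  no cost into `B_{a^{r+m}} B_ν` (`sum_Bvec_append_rectangle`). For each of the `n` positions `j`
  their product is a combination of elementary symmetric functions of the shifts of the entries in
  the block `v`, and so by Pieri's rule it leads to vectors `(a^r, a^m + μ)` with partitions `μ`
  whose parts are at most `n ≤ r`. For `μ ≠ 0` two entries of `(a^r, a^m + μ) + ρ` agree, and the
  operator is zero.

Now both sides carry the same factors: those within the three blocks, between `u` and `v`, and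
between `v` and `w` (`sum_Bvec_append_comm`).
-/

noncomputable section

namespace SymFn

/-! ### The quadratic relation between the vertex operators -/

section Vertex

open MvPolynomial
variable {K : Type*} [Field K]

theorem z_add_single (m : ℕ+ →₀ ℕ) (k : ℕ+) :
    (z (m + Finsupp.single k 1) : K) = z m * (((k : ℕ) : K) * (m k + 1 : ℕ)) := by
  have h1 : ∀ m : ℕ+ →₀ ℕ, (z m : K) =
      ((k : ℕ) : K) ^ (m k) * ((m k).factorial : K) * z (m.erase k) := fun m =>
    (Finsupp.mul_prod_erase' m k _ (by simp)).symm
  rw [h1 (m + _), h1 m, Finsupp.erase_add, Finsupp.erase_single, add_zero]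
  simp only [Finsupp.add_apply, Finsupp.single_eq_same, Nat.factorial_succ, pow_succ]
  push_cast
  ring

section skew
variable [CharZero K]

theorem perp_mul (f g : Lam K) : perp (f * g) = perp f * perp g := by
  ext1 x
  refine LinearMap.ext fun c => hall_nondeg fun q => ?_
  simp only [LinearMap.coe_comp, Function.comp_apply, Module.End.mul_apply]
  rw [mul_comm, hall_perp, hall_perp, hall_perp, mul_assoc]

theorem perp_one : perp (1 : Lam K) = 1 := by
  refine LinearMap.ext fun c => hall_nondeg fun q => ?_
  rw [hall_perp, one_mul, Module.End.one_apply]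

theorem perp_comm (f g x : Lam K) : perp f (perp g x) = perp g (perp f x) := by
  rw [← Module.End.mul_apply, ← Module.End.mul_apply, ← perp_mul, ← perp_mul, mul_comm]

/-- `p_k^⊥ = k ∂/∂p_k`. -/
theorem perp_X (k : ℕ+) (f : Lam K) : perp (X k) f = ((k : ℕ) : K) • pderiv k f := by
  induction f using MvPolynomial.induction_on' with
  | add f g hf hg => simp only [map_add, hf, hg, smul_add]
  | monomial m c =>
    rw [X, perp_monomial, one_smul, perpMon_monomial, pderiv_monomial, smul_monomial]
    by_cases hm : Finsupp.single k 1 ≤ m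
    · obtain ⟨m, rfl⟩ := exists_add_of_le hm
      rw [if_pos hm, add_tsub_cancel_left, add_comm, z_add_single]
      congr 1
      field_simp [z_ne_zero (K := K) m]
      simp only [Finsupp.add_apply, Finsupp.single_eq_same]
      push_cast
      ring
    · rw [if_neg hm]
      have : m k = 0 := by
        by_contra h0
        exact hm (by rw [Finsupp.single_le_iff]; omega)
      simp [this]

end skew

/-- The algebra homomorphism `Λ → Λ[u]` with `p_k ↦ p_k + (t^k - 1) u^k`. -/
def shift (t : K) : Lam K →ₐ[K] Polynomial (Lam K) :=
  aeval fun k : ℕ+ =>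
    Polynomial.C (X k) + Polynomial.C (C (t ^ (k : ℕ) - 1)) * Polynomial.X ^ (k : ℕ)

theorem shift_X (t : K) (k : ℕ+) : shift t (X k) =
    Polynomial.C (X k) + Polynomial.C (C (t ^ (k : ℕ) - 1)) * Polynomial.X ^ (k : ℕ) := by
  simp [shift]

theorem coeff_zero_shift (t : K) (g : Lam K) : (shift t g).coeff 0 = g := by
  induction g using MvPolynomial.induction_on with
  | C c => simp
  | add f g hf hg => simp [hf, hg]
  | mul_X g k hg =>
    simp [hg, shift_X, Polynomial.mul_coeff_zero, Polynomial.coeff_X_pow, k.ne_zero.symm]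

/-- The chain rule `u ∂/∂u shift(g) = ∑_k k (t^k - 1) u^k shift(∂g/∂p_k)`. Its right-hand side is
cut off after `k = N`, and so the two sides agree modulo `u^(N+1)`. -/
theorem X_pow_dvd_derivative_shift (t : K) (N : ℕ) (g : Lam K) :
    Polynomial.X ^ (N + 1) ∣ Polynomial.X * Polynomial.derivative (shift t g) -
      ∑ i : Fin N, Polynomial.C (C ((t ^ ((i : ℕ) + 1) - 1) * ((i : ℕ) + 1 : ℕ))) *
        Polynomial.X ^ ((i : ℕ) + 1) * shift t (pderiv (Nat.succPNat i) g) := by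
  induction g using MvPolynomial.induction_on with
  | C c => simp
  | add f g hf hg =>
    convert dvd_add hf hg using 1
    simp only [map_add, mul_add, Finset.sum_add_distrib]
    ring
  | mul_X g k hg =>
    have h1 : ∀ i : ℕ, pderiv (Nat.succPNat i) (g * X k : Lam K) =
        pderiv (Nat.succPNat i) g * X k + if i + 1 = (k : ℕ) then g else 0 := by
      intro i
      rw [Derivation.leibniz, pderiv_X, smul_eq_mul, smul_eq_mul]
      have : (k = Nat.succPNat i) ↔ i + 1 = (k : ℕ) := by
        rw [← PNat.coe_inj, Nat.succPNat_coe, eq_comm]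
      simp only [Pi.single_apply, this]
      split_ifs <;> ring
    have h2 : ∀ i : ℕ, shift t (pderiv (Nat.succPNat i) (g * X k)) =
        shift t (pderiv (Nat.succPNat i) g) * shift t (X k) +
          if i + 1 = (k : ℕ) then shift t g else 0 := by
      intro i
      rw [h1]; split_ifs <;> simp
    have h3 : Polynomial.X * Polynomial.derivative (shift t (X k)) =
        Polynomial.C (C ((t ^ (k : ℕ) - 1) * (k : ℕ))) * Polynomial.X ^ (k : ℕ) := by
      obtain ⟨j, hj⟩ : ∃ j, (k : ℕ) = j + 1 := ⟨k.natPred, (PNat.natPred_add_one k).symm⟩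
      rw [shift_X, hj]
      generalize t ^ (j + 1) - 1 = c
      simp
      ring
    have h4 : Polynomial.X ^ (N + 1) ∣ (shift t g *
        (Polynomial.C (C ((t ^ (k : ℕ) - 1) * (k : ℕ))) * Polynomial.X ^ (k : ℕ)) - ∑ i : Fin N,
        Polynomial.C (C ((t ^ ((i : ℕ) + 1) - 1) * ((i : ℕ) + 1 : ℕ))) *
        Polynomial.X ^ ((i : ℕ) + 1) * if (i : ℕ) + 1 = (k : ℕ) then shift t g else 0) := by
      by_cases hk : (k : ℕ) ≤ N
      · have hk0 := k.pos
        rw [Finset.sum_eq_single (⟨(k : ℕ) - 1, by omega⟩ : Fin N)]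
        · have hk1 : (k : ℕ) - 1 + 1 = k := by omega
          simp only [hk1, if_true]
          convert dvd_zero _ using 1
          ring
        · rintro i - hi
          rw [if_neg, mul_zero]
          rintro h5
          exact hi (Fin.ext (by simp [← h5]))
        · simp
      · rw [Finset.sum_eq_zero, sub_zero]
        · exact ((pow_dvd_pow _ (by omega)).mul_left _).mul_left _
        · intro i _
          rw [if_neg (by omega), mul_zero]
    convert dvd_add (hg.mul_right (shift t (X k))) h4 using 1
    rw [← h3]
    simp only [h2, mul_add, Finset.sum_add_distrib, map_mul (shift t), Polynomial.derivative_mul]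
    simp only [sub_mul, Finset.sum_mul]
    simp only [mul_assoc]
    ring

theorem coeff_succ_shift (t : K) (n : ℕ) (g : Lam K) :
    C ((n + 1 : ℕ) : K) * (shift t g).coeff (n + 1) =
      ∑ i : Fin (n + 1), C ((t ^ ((i : ℕ) + 1) - 1) * ((i : ℕ) + 1 : ℕ)) *
        (shift t (pderiv (Nat.succPNat i) g)).coeff (n - i) := by
  have h1 := Polynomial.X_pow_dvd_iff.1 (X_pow_dvd_derivative_shift t (n + 1) g) (n + 1)
    (by omega)
  rw [Polynomial.coeff_sub, sub_eq_zero, Polynomial.finsetSum_coeff, Polynomial.coeff_X_mul,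
    Polynomial.coeff_derivative] at h1
  rw [mul_comm]
  convert h1 using 1
  · simp
  · refine Finset.sum_congr rfl fun i _ => ?_
    rw [mul_assoc, Polynomial.coeff_C_mul, Polynomial.coeff_X_pow_mul', if_pos (by omega)]
    congr 2
    omega

/-- `h_n[X(t-1)]^⊥` is the coefficient of `u^n` in `shift t`, so the generating function
`∑_n u^n h_n[X(t-1)]^⊥` is an algebra homomorphism. -/
theorem perp_pleth_h [CharZero K] (t : K) (n : ℕ) (g : Lam K) :
    perp (pleth t (h K n)) g = (shift t g).coeff n := by
  induction n using Nat.strong_induction_on generalizing g with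
  | _ n ih =>
    cases n with
    | zero => rw [h, map_one, perp_one, Module.End.one_apply, coeff_zero_shift]
    | succ n =>
      have hn : ((n + 1 : ℕ) : K) ≠ 0 := by exact_mod_cast n.succ_ne_zero
      have h1 : ∀ (c : K) (f : Lam K), perp (C c * f) = c • perp f := by
        intro c f; rw [C_mul', map_smul]
      have h2 : C ((n + 1 : ℕ) : K) * perp (pleth t (h K (n + 1))) g =
          C ((n + 1 : ℕ) : K) * (shift t g).coeff (n + 1) := by
        rw [coeff_succ_shift, h, map_mul, algHom_C, algebraMap_eq, h1, LinearMap.smul_apply,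
          C_mul', smul_smul, mul_inv_cancel₀ hn, one_smul, map_sum, map_sum, LinearMap.sum_apply]
        refine Finset.sum_congr rfl fun i _ => ?_
        have h3 : pleth t (X (Nat.succPNat i)) =
            C (t ^ ((i : ℕ) + 1) - 1) * X (Nat.succPNat i) := by
          simp [pleth]
        rw [map_mul, h3, mul_assoc, h1, LinearMap.smul_apply, mul_comm (X _), perp_mul,
          Module.End.mul_apply, ih _ (by omega), perp_X, map_smul, Polynomial.coeff_smul,
          smul_smul, C_mul', Nat.succPNat_coe]
      exact mul_left_cancel₀ (C_ne_zero.2 hn) h2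

theorem eq_of_derivative_eq_mul {R : Type*} [CommRing R] [IsDomain R] [CharZero R]
    {F F' G : PowerSeries R}
    (h0 : PowerSeries.constantCoeff F = PowerSeries.constantCoeff F')
    (h1 : PowerSeries.derivative R F = G * F) (h2 : PowerSeries.derivative R F' = G * F') :
    F = F' := by
  ext n
  induction n using Nat.strong_induction_on with
  | _ n ih =>
    cases n with
    | zero => simpa using h0
    | succ n =>
      have h3 := congrArg (PowerSeries.coeff n) h1
      have h4 := congrArg (PowerSeries.coeff n) h2
      rw [PowerSeries.coeff_derivative, PowerSeries.coeff_mul] at h3 h4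
      have h5 : ((n : R) + 1) ≠ 0 := by exact_mod_cast n.succ_ne_zero
      refine mul_right_cancel₀ h5 ?_
      rw [h3, h4]
      refine Finset.sum_congr rfl fun x hx => ?_
      rw [ih _ (by have := Finset.HasAntidiagonal.mem_antidiagonal.1 hx; omega)]

theorem one_sub_mul_mk_pow_succ {R : Type*} [CommRing R] (c : R) :
    (1 - PowerSeries.C c * PowerSeries.X) * PowerSeries.mk (fun n => c ^ (n + 1)) =
      PowerSeries.C c := by
  ext n
  rw [sub_mul, one_mul, map_sub, mul_assoc, PowerSeries.coeff_C_mul]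
  cases n with
  | zero => simp
  | succ n => simp [PowerSeries.coeff_succ_X_mul, pow_succ']

theorem derivative_one_sub_mul {R : Type*} [CommRing R] (c : R) (F : PowerSeries R) :
    PowerSeries.derivative R ((1 - PowerSeries.C c * PowerSeries.X) * F) =
      (1 - PowerSeries.C c * PowerSeries.X) * PowerSeries.derivative R F -
        PowerSeries.C c * F := by
  rw [Derivation.leibniz, map_sub, Derivation.leibniz]
  simp [PowerSeries.derivative_C]
  ring

theorem succ_mul_h [CharZero K] (n : ℕ) : (n + 1 : Lam K) * h K (n + 1) =
    ∑ x ∈ Finset.HasAntidiagonal.antidiagonal n, X (Nat.succPNat x.1) * h K x.2 := by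
  have hn : ((n + 1 : ℕ) : K) ≠ 0 := by exact_mod_cast n.succ_ne_zero
  have h1 : (n + 1 : Lam K) = C ((n + 1 : ℕ) : K) := by simp
  rw [h, h1, ← mul_assoc, ← C_mul, mul_inv_cancel₀ hn, C_1, one_mul,
    Finset.Nat.sum_antidiagonal_eq_sum_range_succ
      (fun i j => (X (Nat.succPNat i) * h K j : Lam K)) n,
    Fin.sum_univ_eq_sum_range (fun i => (X (Nat.succPNat i) * h K (n - i) : Lam K))]

/-- With `H(s) = ∑ h_k s^k`, this is `(1 - tus) shift(H(s)) = (1 - us) H(s)`: both sides satisfy the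
same first order linear differential equation in `s`. -/
theorem shift_h_succ [CharZero K] (t : K) (k : ℕ) :
    shift t (h K (k + 1)) - Polynomial.C (C t) * Polynomial.X * shift t (h K k) =
      Polynomial.C (h K (k + 1)) - Polynomial.X * Polynomial.C (h K k) := by
  set u : Polynomial (Lam K) := Polynomial.X
  set tu : Polynomial (Lam K) := Polynomial.C (C t) * u
  let H : PowerSeries (Polynomial (Lam K)) := PowerSeries.mk fun n => Polynomial.C (h K n)
  let T : PowerSeries (Polynomial (Lam K)) := PowerSeries.mk fun n => shift t (h K n)
  let P : PowerSeries (Polynomial (Lam K)) :=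
    PowerSeries.mk fun n => Polynomial.C (X (Nat.succPNat n))
  let g (c : Polynomial (Lam K)) : PowerSeries (Polynomial (Lam K)) :=
    PowerSeries.mk fun n => c ^ (n + 1)
  have hg (c) : (1 - PowerSeries.C c * PowerSeries.X) * g c = PowerSeries.C c :=
    one_sub_mul_mk_pow_succ c
  have hH : PowerSeries.derivative _ H = P * H := by
    ext1 n
    rw [PowerSeries.coeff_derivative, PowerSeries.coeff_mul]
    simp only [H, P, PowerSeries.coeff_mk, ← Polynomial.C_mul, ← map_sum]
    rw [← succ_mul_h, mul_comm]
    simp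
  have hT : PowerSeries.derivative _ T = (P + g tu - g u) * T := by
    ext1 n
    rw [PowerSeries.coeff_derivative, PowerSeries.coeff_mul]
    have h1 := congrArg (shift t) (succ_mul_h (K := K) n)
    rw [map_mul, map_sum] at h1
    simp only [T, P, g, PowerSeries.coeff_mk, map_add, map_sub]
    rw [mul_comm]
    convert h1 using 1
    · simp
    · refine Finset.sum_congr rfl fun x _ => ?_
      rw [map_mul, shift_X, Nat.succPNat_coe]
      simp only [tu, mul_pow, Nat.succ_eq_add_one, map_sub, map_pow, map_one]
      ring
  have key : (1 - PowerSeries.C tu * PowerSeries.X) * T =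
      (1 - PowerSeries.C u * PowerSeries.X) * H := by
    refine eq_of_derivative_eq_mul (G := P - g u) ?_ ?_ ?_
    · simp [T, H, h]
    · rw [derivative_one_sub_mul, hT]; linear_combination T * hg tu
    · rw [derivative_one_sub_mul, hH]; linear_combination H * hg u
  have := congrArg (PowerSeries.coeff (k + 1)) key
  simpa [sub_mul, mul_assoc, PowerSeries.coeff_succ_X_mul, H, T, tu] using this

theorem shift_hInt [CharZero K] (t : K) (k : ℤ) :
    shift t (hInt K k) - Polynomial.C (C t) * Polynomial.X * shift t (hInt K (k - 1)) =
      Polynomial.C (hInt K k) - Polynomial.X * Polynomial.C (hInt K (k - 1)) := by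
  rcases lt_trichotomy k 0 with hk | rfl | hk
  · rw [hInt, hInt, if_neg (by omega), if_neg (by omega)]; simp
  · simp [hInt, h]
  · obtain ⟨k, rfl⟩ : ∃ j : ℕ, k = j + 1 := ⟨(k - 1).toNat, by omega⟩
    have h1 : hInt K ((k : ℤ) + 1) = h K (k + 1) := by
      rw [hInt, if_pos (by omega)]; congr
    have h2 : hInt K ((k : ℤ) + 1 - 1) = h K k := by
      rw [hInt, if_pos (by omega)]; congr; omega
    rw [h1, h2, shift_h_succ]

/-- The commutation relation of `h_i[X(t-1)]^⊥` and multiplication by `h_k`. -/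
theorem perp_pleth_hInt_mul [CharZero K] (t : K) (i : ℕ) (k : ℤ) (g : Lam K) :
    perp (pleth t (h K (i + 1))) (hInt K k * g) -
        t • perp (pleth t (h K i)) (hInt K (k - 1) * g) =
      hInt K k * perp (pleth t (h K (i + 1))) g -
        hInt K (k - 1) * perp (pleth t (h K i)) g := by
  have h1 := congrArg (fun f => (f * shift t g).coeff (i + 1)) (shift_hInt t k)
  simp only [perp_pleth_h, map_mul]
  simpa [sub_mul, mul_assoc, Polynomial.coeff_X_mul, ← C_mul'] using h1

theorem perp_pleth_h_zero [CharZero K] (t : K) (g : Lam K) : perp (pleth t (h K 0)) g = g := by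
  rw [perp_pleth_h, coeff_zero_shift]

theorem exists_bound (t : K) (g : Lam K) :
    ∃ N, ∀ i, N ≤ i → perp (pleth t (h K i)) g = 0 :=
  ⟨MvPolynomial.weightedTotalDegree wt g + 1, fun i hi =>
    perp_eq_zero (pleth_h_homogeneous t i) (by omega)⟩

theorem B_eq_sum (t : K) (l : ℤ) {g : Lam K} {N : ℕ}
    (hN : ∀ i, N ≤ i → perp (pleth t (h K i)) g = 0) :
    B t l g = ∑ i ∈ Finset.range N, hInt K (i + l) * perp (pleth t (h K i)) g := by
  refine finsum_eq_sum_of_support_subset _ fun i hi => ?_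
  by_contra h1
  exact hi (by simp [hN i (by simpa using h1)])

/-- The normally ordered product `∑_{i,k<N} h_{i+a} h_{k+b} D_i D_k g`, where
`D_i = h_i[X(t-1)]^⊥`. -/
def normalOrdered (t : K) (N : ℕ) (a b : ℤ) (g : Lam K) : Lam K :=
  ∑ k ∈ Finset.range N, ∑ i ∈ Finset.range N,
    hInt K (i + a) * (hInt K (k + b) * perp (pleth t (h K i)) (perp (pleth t (h K k)) g))

theorem normalOrdered_comm [CharZero K] (t : K) (N : ℕ) (a b : ℤ) (g : Lam K) :
    normalOrdered t N a b g = normalOrdered t N b a g := by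
  rw [normalOrdered, Finset.sum_comm, normalOrdered]
  refine Finset.sum_congr rfl fun i _ => Finset.sum_congr rfl fun k _ => ?_
  rw [perp_comm]; ring

/-- The generating function form is `(1 - t w/z) B(z) B(w) = (1 - w/z) :B(z) B(w):`. -/
theorem B_mul_B_sub_eq_normalOrdered [CharZero K] (t : K) (g : Lam K) {N : ℕ}
    (hN : ∀ i, N ≤ i → perp (pleth t (h K i)) g = 0) (a b : ℤ) :
    B t a (B t b g) - t • B t (a + 1) (B t (b - 1) g) =
      normalOrdered t N a b g - normalOrdered t N (a + 1) (b - 1) g := by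
  -- a common bound for the finitely many arguments of the outer operators
  obtain ⟨M, hNM, hM⟩ : ∃ M, N ≤ M ∧ ∀ k < N, ∀ c ∈ ({b, b - 1} : Finset ℤ), ∀ i, M ≤ i →
      perp (pleth t (h K i)) (hInt K (k + c) * perp (pleth t (h K k)) g) = 0 := by
    choose f hf using fun (k : ℕ) (c : ℤ) =>
      exists_bound t (hInt K (k + c) * perp (pleth t (h K k)) g)
    refine ⟨N + ∑ k ∈ Finset.range N, ∑ c ∈ ({b, b - 1} : Finset ℤ), f k c, by omega,
      fun k hk c hc i hi => hf _ _ _ ?_⟩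
    have h1 := Finset.single_le_sum (f := fun k => ∑ c ∈ ({b, b - 1} : Finset ℤ), f k c)
      (fun _ _ => Nat.zero_le _) (Finset.mem_range.2 hk)
    have h2 := Finset.single_le_sum (f := f k) (fun _ _ => Nat.zero_le _) hc
    omega
  have hB : ∀ (l : ℤ), ∀ c ∈ ({b, b - 1} : Finset ℤ), B t l (B t c g) =
      ∑ k ∈ Finset.range N, ∑ i ∈ Finset.range M, hInt K (i + l) *
        perp (pleth t (h K i)) (hInt K (k + c) * perp (pleth t (h K k)) g) := by
    intro l c hc
    rw [B_eq_sum t c hN, map_sum]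
    exact Finset.sum_congr rfl fun k hk => B_eq_sum t l (hM k (Finset.mem_range.1 hk) c hc)
  have hNO : ∀ a b : ℤ, normalOrdered t N a b g =
      ∑ k ∈ Finset.range N, ∑ i ∈ Finset.range (M + 1), hInt K (i + a) *
        (hInt K (k + b) * perp (pleth t (h K i)) (perp (pleth t (h K k)) g)) := by
    intro a b
    refine Finset.sum_congr rfl fun k _ => Finset.sum_subset
      (Finset.range_subset_range.2 (by omega)) fun i _ hi => ?_
    rw [perp_comm, hN i (by simpa using hi), map_zero, mul_zero, mul_zero]
  have hB' : ∀ (l : ℤ), ∀ c ∈ ({b, b - 1} : Finset ℤ), B t l (B t c g) =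
      ∑ k ∈ Finset.range N, ∑ i ∈ Finset.range (M + 1), hInt K (i + l) *
        perp (pleth t (h K i)) (hInt K (k + c) * perp (pleth t (h K k)) g) := by
    intro l c hc
    rw [hB l c hc]
    refine Finset.sum_congr rfl fun k hk => ?_
    rw [Finset.sum_range_succ, hM k (Finset.mem_range.1 hk) c hc M le_rfl, mul_zero, add_zero]
  have hNO' : normalOrdered t N (a + 1) (b - 1) g =
      ∑ k ∈ Finset.range N, ∑ i ∈ Finset.range M, hInt K (i + (a + 1)) *
        (hInt K (k + (b - 1)) * perp (pleth t (h K i)) (perp (pleth t (h K k)) g)) := by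
    rw [normalOrdered]
    refine Finset.sum_congr rfl fun k _ => Finset.sum_subset
      (Finset.range_subset_range.2 (by omega)) fun i _ hi => ?_
    rw [perp_comm, hN i (by simpa using hi), map_zero, mul_zero, mul_zero]
  rw [hB' a b (by simp), hB (a + 1) (b - 1) (by simp), hNO a b, hNO', Finset.smul_sum,
    ← Finset.sum_sub_distrib, ← Finset.sum_sub_distrib]
  refine Finset.sum_congr rfl fun k _ => ?_
  rw [Finset.sum_range_succ', Finset.sum_range_succ', Finset.smul_sum, add_sub_right_comm,
    add_sub_right_comm, ← Finset.sum_sub_distrib, ← Finset.sum_sub_distrib]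
  congr 1
  · refine Finset.sum_congr rfl fun i _ => ?_
    have h1 := perp_pleth_hInt_mul t i (k + b) (perp (pleth t (h K k)) g)
    rw [show (i : ℤ) + (a + 1) = ((i + 1 : ℕ) : ℤ) + a by push_cast; ring,
      ← mul_smul_comm, ← mul_sub, ← mul_sub, ← add_sub_assoc, h1]
  · rw [perp_pleth_h_zero, perp_pleth_h_zero]

/-- The quadratic relation between the operators `B_ℓ`: the operator `B_{(a,b)}` changes its sign
under `(a, b) ↦ (b - 1, a + 1)`, as the normally ordered products are symmetric. -/
theorem B_mul_B_sub [CharZero K] (t : K) (a b : ℤ) :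
    B t a * B t b - t • (B t (a + 1) * B t (b - 1)) =
      -(B t (b - 1) * B t (a + 1) - t • (B t b * B t a)) := by
  refine LinearMap.ext fun g => ?_
  obtain ⟨N, hN⟩ := exists_bound t g
  have h1 := B_mul_B_sub_eq_normalOrdered t g hN a b
  have h2 := B_mul_B_sub_eq_normalOrdered t g hN (b - 1) (a + 1)
  rw [sub_add_cancel, add_sub_cancel_right, normalOrdered_comm, normalOrdered_comm t N b] at h2
  simp only [LinearMap.sub_apply, LinearMap.neg_apply, LinearMap.smul_apply,
    Module.End.mul_apply]
  rw [h1, h2]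
  ring

end Vertex

section Concatenation

variable {K : Type*} [Field K]

/-! ### Sums over `0`-`1` matrices -/

section BoolMatrix
variable {ι κ : Type*}

/-- The row sums of a `0`-`1` matrix; the matrix `S` has the entry `1` where `S i j` is true. -/
def rowSum [Fintype κ] (S : ι → κ → Bool) (i : ι) : ℤ := ∑ j, ((S i j).toNat : ℤ)

/-- The column sums of a `0`-`1` matrix. -/
def colSum [Fintype ι] (S : ι → κ → Bool) (j : κ) : ℤ := ∑ i, ((S i j).toNat : ℤ)

/-- The number of entries `1` of a `0`-`1` matrix. -/
def weight [Fintype ι] [Fintype κ] (S : ι → κ → Bool) : ℕ := ∑ i, ∑ j, (S i j).toNat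

theorem sum_rowSum [Fintype ι] [Fintype κ] (S : ι → κ → Bool) : ∑ i, rowSum S i = weight S := by
  simp [rowSum, weight]

theorem rowSum_comp [Fintype κ] (S : ι → κ → Bool) (σ : Equiv.Perm ι) (τ : Equiv.Perm κ) :
    rowSum (fun i j => S (σ i) (τ j)) = rowSum S ∘ σ :=
  funext fun i => Equiv.sum_comp τ fun j => ((S (σ i) j).toNat : ℤ)

theorem colSum_comp [Fintype ι] (S : ι → κ → Bool) (σ : Equiv.Perm ι) (τ : Equiv.Perm κ) :
    colSum (fun i j => S (σ i) (τ j)) = colSum S ∘ τ :=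
  funext fun j => Equiv.sum_comp σ fun i => ((S i (τ j)).toNat : ℤ)

theorem weight_comp [Fintype ι] [Fintype κ] (S : ι → κ → Bool)
    (σ : Equiv.Perm ι) (τ : Equiv.Perm κ) :
    weight (fun i j => S (σ i) (τ j)) = weight S := by
  have := congrArg (fun f : ι → ℤ => ∑ i, f i) (rowSum_comp S σ τ)
  simp only [sum_rowSum, Function.comp_apply, Equiv.sum_comp σ (rowSum S)] at this
  exact_mod_cast this

theorem sum_boolMatrix_comp [Fintype ι] [Fintype κ] [DecidableEq ι] [DecidableEq κ]
    {E : Type*} [AddCommMonoid E] (f : (ι → κ → Bool) → E) (σ : Equiv.Perm ι) (τ : Equiv.Perm κ) :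
    ∑ S : ι → κ → Bool, f (fun i j => S (σ i) (τ j)) = ∑ S, f S :=
  Equiv.sum_comp (Equiv.arrowCongr σ.symm (Equiv.arrowCongr τ.symm (Equiv.refl Bool))) f

/-- Distributivity: a product of binomials in a group algebra, indexed by the cells of a matrix,
is a sum over `0`-`1` matrices. -/
theorem prod_prod_sum_single [Fintype ι] [Fintype κ] [DecidableEq ι] [DecidableEq κ]
    {R M : Type*} [CommSemiring R] [AddCommMonoid M] (α : ι → κ → Bool → M) (c : Bool → R) :
    ∏ i, ∏ j, ∑ b, AddMonoidAlgebra.single (α i j b) (c b) =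
      ∑ S : ι → κ → Bool, AddMonoidAlgebra.single (∑ i, ∑ j, α i j (S i j))
        (∏ i, ∏ j, c (S i j)) := by
  simp only [Fintype.prod_sum, AddMonoidAlgebra.prod_single]

end BoolMatrix

/-! ### Concatenation -/

/-- The linear extension of `w ↦ B_{w_1} ⋯ B_{w_L}` to the group algebra of `ℤ^L`. -/
def evalB (t : K) (L : ℕ) : AddMonoidAlgebra K (Fin L → ℤ) →+ Module.End K (Lam K) where
  toFun P := Finsupp.linearCombination K (fun w : Fin L → ℤ => Bprod t w) P.coeff
  map_zero' := by simp
  map_add' P Q := by simp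

theorem evalB_single (t : K) (L : ℕ) (w : Fin L → ℤ) (c : K) :
    evalB t L (AddMonoidAlgebra.single w c) = c • Bprod t w := by
  simp [evalB]

theorem Bvec_eq (t : K) {L : ℕ} (v : Fin L → ℤ) :
    Bvec t v = evalB t L (raising t L * AddMonoidAlgebra.single v 1) := rfl

theorem Bprod_append (t : K) {p q : ℕ} (u : Fin p → ℤ) (v : Fin q → ℤ) :
    Bprod t (Fin.append u v) = Bprod t u * Bprod t v := by
  rw [Bprod, Bprod, Bprod, ← List.prod_append, ← List.ofFn_fin_append]
  congr 2
  ext1 i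
  refine Fin.addCases (fun i => ?_) (fun i => ?_) i <;> simp

/-- Extension of vectors by zeros on the right. -/
def appendZero (p q : ℕ) : (Fin p → ℤ) →+ (Fin (p + q) → ℤ) where
  toFun u := Fin.append u 0
  map_zero' := by ext i; refine Fin.addCases (fun i => ?_) (fun i => ?_) i <;> simp
  map_add' u v := by ext i; refine Fin.addCases (fun i => ?_) (fun i => ?_) i <;> simp

/-- Extension of vectors by zeros on the left. -/
def zeroAppend (p q : ℕ) : (Fin q → ℤ) →+ (Fin (p + q) → ℤ) where
  toFun v := Fin.append 0 v
  map_zero' := by ext i; refine Fin.addCases (fun i => ?_) (fun i => ?_) i <;> simp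
  map_add' u v := by ext i; refine Fin.addCases (fun i => ?_) (fun i => ?_) i <;> simp

theorem appendZero_single {p q : ℕ} (i : Fin p) (c : ℤ) :
    appendZero p q (Pi.single i c) = Pi.single (Fin.castAdd q i) c := by
  ext k
  refine Fin.addCases (fun k => ?_) (fun k => ?_) k
  · simp [appendZero, Pi.single_apply]
  · simp [appendZero, Pi.single_apply, Fin.ext_iff]; omega

theorem zeroAppend_single {p q : ℕ} (i : Fin q) (c : ℤ) :
    zeroAppend p q (Pi.single i c) = Pi.single (Fin.natAdd p i) c := by
  ext k
  refine Fin.addCases (fun k => ?_) (fun k => ?_) k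
  · simp [zeroAppend, Pi.single_apply, Fin.ext_iff]; omega
  · simp [zeroAppend, Pi.single_apply, Fin.ext_iff]

theorem appendZero_add_zeroAppend {p q : ℕ} (u : Fin p → ℤ) (v : Fin q → ℤ) :
    appendZero p q u + zeroAppend p q v = Fin.append u v := by
  ext k
  refine Fin.addCases (fun k => ?_) (fun k => ?_) k <;> simp [appendZero, zeroAppend]

theorem evalB_append (t : K) (p q : ℕ) (P : AddMonoidAlgebra K (Fin p → ℤ))
    (Q : AddMonoidAlgebra K (Fin q → ℤ)) :
    evalB t (p + q) (AddMonoidAlgebra.mapDomainRingHom K (appendZero p q) P *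
        AddMonoidAlgebra.mapDomainRingHom K (zeroAppend p q) Q) =
      evalB t p P * evalB t q Q := by
  induction P using AddMonoidAlgebra.induction_linear with
  | zero => simp
  | add P P' h1 h2 => simp only [map_add, add_mul, h1, h2]
  | single u c =>
    induction Q using AddMonoidAlgebra.induction_linear with
    | zero => simp
    | add Q Q' h1 h2 => simp only [map_add, mul_add, h1, h2]
    | single v d =>
      simp only [AddMonoidAlgebra.mapDomainRingHom_apply, AddMonoidAlgebra.mapDomain_single,
        AddMonoidAlgebra.single_mul_single, evalB_single, appendZero_add_zeroAppend, Bprod_append]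
      rw [smul_mul_smul_comm]

theorem prod_lt_append {M : Type*} [CommMonoid M] {p q : ℕ}
    (f : Fin (p + q) → Fin (p + q) → M) :
    (∏ i, ∏ j, if i < j then f i j else 1) =
      (∏ i : Fin p, ∏ j : Fin p, if i < j then f (Fin.castAdd q i) (Fin.castAdd q j) else 1) *
      (∏ i : Fin q, ∏ j : Fin q, if i < j then f (Fin.natAdd p i) (Fin.natAdd p j) else 1) *
      ∏ i : Fin p, ∏ j : Fin q, f (Fin.castAdd q i) (Fin.natAdd p j) := by
  have h1 : ∀ (i : Fin p) (j : Fin q), Fin.castAdd q i < Fin.natAdd p j := fun i j => by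
    rw [Fin.lt_def]; simp; omega
  have h2 : ∀ (i : Fin p) (j : Fin q), ¬ Fin.natAdd p j < Fin.castAdd q i := fun i j =>
    (h1 i j).not_gt
  have h3 : ∀ i j : Fin p, Fin.castAdd q i < Fin.castAdd q j ↔ i < j := fun _ _ => Iff.rfl
  simp only [Fin.prod_univ_add, h1, h2, if_true, if_false, Finset.prod_mul_distrib,
    Finset.prod_const_one, h3, Fin.natAdd_lt_natAdd_iff]
  rw [mul_assoc, mul_assoc, mul_comm (∏ i : Fin p, ∏ j : Fin q, _),
    one_mul]

theorem raising_eq (t : K) (L : ℕ) : raising t L = ∏ i : Fin L, ∏ j : Fin L,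
    if i < j then 1 - AddMonoidAlgebra.single (Pi.single i 1 - Pi.single j 1) t else 1 := by
  rw [raising, Finset.prod_filter, Fintype.prod_prod_type]

theorem raising_append (t : K) (p q : ℕ) : raising t (p + q) =
    AddMonoidAlgebra.mapDomainRingHom K (appendZero p q) (raising t p) *
      AddMonoidAlgebra.mapDomainRingHom K (zeroAppend p q) (raising t q) *
      ∏ i : Fin p, ∏ j : Fin q,
        (1 - AddMonoidAlgebra.single
          (Pi.single (Fin.castAdd q i) 1 - Pi.single (Fin.natAdd p j) 1) t) := by
  simp only [raising_eq]
  rw [prod_lt_append]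
  simp only [map_prod, apply_ite (AddMonoidAlgebra.mapDomainRingHom K _), map_one, map_sub,
    AddMonoidAlgebra.mapDomainRingHom_apply, AddMonoidAlgebra.mapDomain_single,
    appendZero_single, zeroAppend_single]

/-- `B_{(u,v)}` through the operators `B_{u'} B_{v'}`: the product over the pairs `i < j` with `i`
in the first and `j` in the second block is expanded as a sum over `0`-`1` matrices. -/
theorem Bvec_append (t : K) {p q : ℕ} (u : Fin p → ℤ) (v : Fin q → ℤ) :
    Bvec t (Fin.append u v) = ∑ S : Fin p → Fin q → Bool,
      (-t) ^ weight S • (Bvec t (u + rowSum S) * Bvec t (v - colSum S)) := by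
  have h1 : ∀ (i : Fin p) (j : Fin q),
      (1 - AddMonoidAlgebra.single
          (Pi.single (Fin.castAdd q i) 1 - Pi.single (Fin.natAdd p j) 1) t :
        AddMonoidAlgebra K (Fin (p + q) → ℤ)) =
      ∑ b : Bool, AddMonoidAlgebra.single ((b.toNat : ℤ) •
        (Pi.single (Fin.castAdd q i) 1 - Pi.single (Fin.natAdd p j) 1)) ((-t) ^ b.toNat) := by
    intro i j
    simp [AddMonoidAlgebra.one_def, sub_eq_add_neg, add_comm,
      AddMonoidAlgebra.single_neg]
  have h2 : ∀ S : Fin p → Fin q → Bool,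
      ∑ i, ∑ j, ((S i j).toNat : ℤ) • (Pi.single (Fin.castAdd q i) 1 -
        Pi.single (Fin.natAdd p j) 1 : Fin (p + q) → ℤ) =
      appendZero p q (rowSum S) + zeroAppend p q (-colSum S) := by
    intro S
    rw [appendZero_add_zeroAppend]
    ext k
    refine Fin.addCases (fun k => ?_) (fun k => ?_) k
    · have h3 : ∀ j : Fin q, Fin.castAdd q k ≠ Fin.natAdd p j := fun j => by
        rw [Ne, Fin.ext_iff]; simp; omega
      simp [Finset.sum_apply, Pi.single_apply, rowSum, h3, Finset.sum_ite_eq, mul_sub]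
    · have h3 : ∀ j : Fin p, Fin.natAdd p k ≠ Fin.castAdd q j := fun j => by
        rw [Ne, Fin.ext_iff]; simp; omega
      simp [Finset.sum_apply, Pi.single_apply, colSum, h3, Finset.sum_ite_eq, mul_sub]
  have h3 : ∀ S : Fin p → Fin q → Bool, ∏ i, ∏ j, (-t) ^ (S i j).toNat = (-t) ^ weight S := by
    intro S; simp only [Finset.prod_pow_eq_pow_sum, weight]
  rw [Bvec_eq, raising_append]
  simp only [h1, prod_prod_sum_single, h2, h3]
  rw [Finset.mul_sum, Finset.sum_mul, map_sum]
  refine Finset.sum_congr rfl fun S _ => ?_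
  have h4 : (AddMonoidAlgebra.single (appendZero p q (rowSum S) + zeroAppend p q (-colSum S))
        ((-t) ^ weight S) : AddMonoidAlgebra K (Fin (p + q) → ℤ)) *
        AddMonoidAlgebra.single (Fin.append u v) 1 =
      AddMonoidAlgebra.mapDomainRingHom K (appendZero p q)
          (AddMonoidAlgebra.single (u + rowSum S) ((-t) ^ weight S)) *
        AddMonoidAlgebra.mapDomainRingHom K (zeroAppend p q)
          (AddMonoidAlgebra.single (v - colSum S) 1) := by
    simp only [AddMonoidAlgebra.mapDomainRingHom_apply, AddMonoidAlgebra.mapDomain_single,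
      AddMonoidAlgebra.single_mul_single, ← appendZero_add_zeroAppend u v, map_add, map_sub,
      map_neg]
    congr 1
    abel
  have h5 : ∀ P : AddMonoidAlgebra K (Fin p → ℤ), ∀ c : K,
      evalB t p (P * AddMonoidAlgebra.single (u + rowSum S) c) =
        c • evalB t p (P * AddMonoidAlgebra.single (u + rowSum S) 1) := by
    intro P c
    induction P using AddMonoidAlgebra.induction_linear with
    | zero => simp
    | add P P' h1 h2 => rw [add_mul, add_mul, map_add, map_add, h1, h2, smul_add]
    | single w d =>
      simp only [AddMonoidAlgebra.single_mul_single, evalB_single, smul_smul, mul_one]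
      rw [mul_comm]
  rw [mul_assoc, h4, mul_mul_mul_comm, ← map_mul, ← map_mul, evalB_append, h5, smul_mul_assoc]
  rfl

/-! ### Antisymmetry of `Bvec` -/

/-- Antisymmetry of a function of integer vectors under the action of the transposition `(i j)`
that becomes the exchange of two entries after a shift by `ρ`, for neighbouring positions `i, j`:
the entries `(a, b)` in the positions `i, j` turn into `(b - 1, a + 1)`. -/
def DotAntisymm {L : ℕ} {E : Type*} [AddGroup E] (F : (Fin L → ℤ) → E) (i j : Fin L) : Prop :=
  ∀ v, F (v ∘ Equiv.swap i j - Pi.single i 1 + Pi.single j 1) = -F v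

theorem Bvec_two (t : K) (v : Fin 2 → ℤ) : Bvec t v =
    B t (v 0) * B t (v 1) - t • (B t (v 0 + 1) * B t (v 1 - 1)) := by
  have h1 : raising t 2 = 1 - AddMonoidAlgebra.single (Pi.single 0 1 - Pi.single 1 1) t := by
    rw [raising_eq]
    simp [Fin.prod_univ_two]
  rw [Bvec_eq, h1, sub_mul, one_mul, map_sub, AddMonoidAlgebra.single_mul_single, evalB_single,
    evalB_single]
  simp [Bprod, List.ofFn_succ, add_comm, sub_eq_add_neg]

theorem dotAntisymm_Bvec_two [CharZero K] (t : K) :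
    DotAntisymm (fun v : Fin 2 → ℤ => Bvec t v) 0 1 := by
  intro v
  have h1 := B_mul_B_sub t (v 1 - 1) (v 0 + 1)
  simp only [Bvec_two]
  simpa [sub_eq_add_neg, add_comm] using h1

/-- In `Bvec_append`, exchanging two rows of the matrices exchanges two entries of the row sums. -/
theorem dotAntisymm_Bvec_castAdd (t : K) {p q : ℕ} {i j : Fin p}
    (H : DotAntisymm (fun v : Fin p → ℤ => Bvec t v) i j) :
    DotAntisymm (fun v : Fin (p + q) → ℤ => Bvec t v) (Fin.castAdd q i) (Fin.castAdd q j) := by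
  intro w
  obtain ⟨u, v, rfl⟩ : ∃ u v, w = Fin.append u v :=
    ⟨_, _, (Fin.append_castAdd_natAdd (f := w)).symm⟩
  have h1 : Fin.append u v ∘ Equiv.swap (Fin.castAdd q i) (Fin.castAdd q j) -
        Pi.single (Fin.castAdd q i) 1 + Pi.single (Fin.castAdd q j) 1 =
      Fin.append (u ∘ Equiv.swap i j - Pi.single i 1 + Pi.single j 1) v := by
    ext k
    refine Fin.addCases (fun k => ?_) (fun k => ?_) k
    · have h2 : Equiv.swap (Fin.castAdd q i) (Fin.castAdd q j) (Fin.castAdd q k) =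
          Fin.castAdd q (Equiv.swap i j k) :=
        (Function.Injective.map_swap (Fin.castAdd_injective p q) i j k).symm
      simp [h2, Pi.single_apply]
    · have h3 : ∀ i : Fin p, Fin.natAdd p k ≠ Fin.castAdd q i := fun j => by
        rw [Ne, Fin.ext_iff]; simp; omega
      simp [Equiv.swap_apply_of_ne_of_ne (h3 i) (h3 j), h3]
  dsimp only
  rw [h1, Bvec_append, Bvec_append, ← Finset.sum_neg_distrib,
    ← sum_boolMatrix_comp _ (Equiv.swap i j) 1]
  refine Finset.sum_congr rfl fun S _ => ?_
  have h2 := H (u + rowSum S)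
  dsimp only at h2
  have h3 : u ∘ Equiv.swap i j - Pi.single i 1 + Pi.single j 1 + rowSum S ∘ Equiv.swap i j =
      (u + rowSum S) ∘ Equiv.swap i j - Pi.single i 1 + Pi.single j 1 := by
    ext k
    simp
    ring
  rw [rowSum_comp, colSum_comp, weight_comp, h3, h2]
  have h4 : ∀ (c : K) (x y : Module.End K (Lam K)), c • (-x * y) = -(c • (x * y)) :=
    fun c x y => LinearMap.ext fun g => smul_neg c (x (y g))
  exact h4 _ _ _

theorem dotAntisymm_Bvec_natAdd (t : K) {p q : ℕ} {i j : Fin q}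
    (H : DotAntisymm (fun v : Fin q → ℤ => Bvec t v) i j) :
    DotAntisymm (fun v : Fin (p + q) → ℤ => Bvec t v) (Fin.natAdd p i) (Fin.natAdd p j) := by
  intro w
  obtain ⟨u, v, rfl⟩ : ∃ u v, w = Fin.append u v :=
    ⟨_, _, (Fin.append_castAdd_natAdd (f := w)).symm⟩
  have h1 : Fin.append u v ∘ Equiv.swap (Fin.natAdd p i) (Fin.natAdd p j) -
        Pi.single (Fin.natAdd p i) 1 + Pi.single (Fin.natAdd p j) 1 =
      Fin.append u (v ∘ Equiv.swap i j - Pi.single i 1 + Pi.single j 1) := by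
    ext k
    refine Fin.addCases (fun k => ?_) (fun k => ?_) k
    · have h3 : ∀ i : Fin q, Fin.castAdd q k ≠ Fin.natAdd p i := fun j => by
        rw [Ne, Fin.ext_iff]; simp; omega
      simp [Equiv.swap_apply_of_ne_of_ne (h3 i) (h3 j), h3]
    · have h2 : Equiv.swap (Fin.natAdd p i) (Fin.natAdd p j) (Fin.natAdd p k) =
          Fin.natAdd p (Equiv.swap i j k) :=
        (Function.Injective.map_swap (Fin.natAdd_injective q p) i j k).symm
      simp [h2, Pi.single_apply]
  dsimp only
  rw [h1, Bvec_append, Bvec_append, ← Finset.sum_neg_distrib,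
    ← sum_boolMatrix_comp _ 1 (Equiv.swap i j)]
  refine Finset.sum_congr rfl fun S _ => ?_
  have h2 := H (v - colSum S)
  dsimp only at h2
  have h3 : v ∘ Equiv.swap i j - Pi.single i 1 + Pi.single j 1 - colSum S ∘ Equiv.swap i j =
      (v - colSum S) ∘ Equiv.swap i j - Pi.single i 1 + Pi.single j 1 := by
    ext k
    simp
    ring
  rw [rowSum_comp, colSum_comp, weight_comp, h3, h2]
  have h4 : ∀ (c : K) (x y : Module.End K (Lam K)), c • (x * -y) = -(c • (x * y)) :=
    fun c x y => LinearMap.ext fun g =>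
      (congrArg (c • ·) (map_neg x (y g))).trans (smul_neg c (x (y g)))
  exact h4 _ _ _

/-- The positions `i` and `i + 1` form the middle block of a vector of three blocks. -/
theorem dotAntisymm_Bvec [CharZero K] (t : K) {L : ℕ} (i : Fin L) :
    DotAntisymm (fun v : Fin (L + 1) → ℤ => Bvec t v) i.castSucc i.succ := by
  obtain ⟨k, hk⟩ := i
  obtain ⟨q, rfl⟩ : ∃ q, L = k + (1 + q) := ⟨L - k - 1, by omega⟩
  have h1 := dotAntisymm_Bvec_natAdd (p := k) t
    (dotAntisymm_Bvec_castAdd (q := q) t (dotAntisymm_Bvec_two t))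
  have h2 : k + (1 + q) + 1 = k + (2 + q) := by omega
  intro v
  have h3 : ∀ (M : ℕ) (h2 : k + (1 + q) + 1 = M) (i j : Fin M), i.val = k → j.val = k + 1 →
      DotAntisymm (fun v : Fin M → ℤ => Bvec t v) i j →
      DotAntisymm (fun v : Fin (k + (1 + q) + 1) → ℤ => Bvec t v)
        (Fin.castSucc ⟨k, hk⟩) (Fin.succ ⟨k, hk⟩) := by
    rintro M rfl i j hi hj h
    convert h using 1
    · exact Fin.ext hi.symm
    · exact Fin.ext hj.symm
  exact h3 _ h2 _ _ (by simp) (by simp) h1 v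

/-- A function of integer vectors that is multiplied by the sign when the entries are permuted. -/
def IsAntisymm {L : ℕ} {E : Type*} [AddCommGroup E] (H : (Fin L → ℤ) → E) : Prop :=
  ∀ (σ : Equiv.Perm (Fin L)) (w : Fin L → ℤ), H (w ∘ σ) = (Equiv.Perm.sign σ : ℤ) • H w

theorem isAntisymm_of_swap {L : ℕ} {E : Type*} [AddCommGroup E] {H : (Fin (L + 1) → ℤ) → E}
    (hH : ∀ (i : Fin L) w, H (w ∘ Equiv.swap i.castSucc i.succ) = -H w) : IsAntisymm H := by
  intro σ
  have h1 : σ ∈ Submonoid.closure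
      (Set.range fun i : Fin L => Equiv.swap i.castSucc i.succ) := by
    rw [Equiv.Perm.mclosure_swap_castSucc_succ]; trivial
  induction h1 using Submonoid.closure_induction with
  | mem x hx =>
    obtain ⟨i, rfl⟩ := hx
    intro w
    rw [hH, Equiv.Perm.sign_swap i.castSucc_lt_succ.ne]
    simp
  | one => intro w; simp
  | mul x y _ _ hx hy =>
    intro w
    rw [Equiv.Perm.coe_mul, ← Function.comp_assoc, hy, hx, smul_smul, Equiv.Perm.sign_mul]
    push_cast
    rw [mul_comm]

/-- `w ↦ B_{w - ρ}` is antisymmetric; here `-ρ = (0, 1, 2, …)`. -/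
theorem isAntisymm_Bvec [CharZero K] (t : K) (L : ℕ) :
    IsAntisymm fun w : Fin L → ℤ => Bvec t fun i => w i + (i : ℕ) := by
  cases L with
  | zero =>
    intro σ w
    rw [Subsingleton.elim σ 1]
    simp
  | succ L =>
    refine isAntisymm_of_swap fun i w => ?_
    have h1 := dotAntisymm_Bvec t i fun j => w j + (j : ℕ)
    dsimp only at h1 ⊢
    rw [← h1]
    congr 1
    ext k
    have hne : i.castSucc ≠ i.succ := i.castSucc_lt_succ.ne
    by_cases hk : k = i.castSucc
    · subst hk
      simp [hne]
      ring
    · by_cases hk' : k = i.succ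
      · subst hk'
        simp [hne.symm]
        ring
      · simp [Equiv.swap_apply_of_ne_of_ne hk hk', hk, hk']

end Concatenation

/-! ### The dual Cauchy identity -/

theorem prod_Ioi_eq_prod_ite {n : ℕ} {M : Type*} [CommMonoid M] (f : Fin n → Fin n → M) :
    ∏ i, ∏ j ∈ Finset.Ioi i, f i j = ∏ i, ∏ j, if i < j then f i j else 1 := by
  refine Finset.prod_congr rfl fun i _ => ?_
  rw [← Finset.prod_filter]
  congr 1
  ext j
  simp

theorem prod_sub_eq_sum_perm {n : ℕ} {R : Type*} [CommRing R] (x : Fin n → R) :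
    (∏ i, ∏ j, if i < j then x j - x i else 1) =
      ∑ σ : Equiv.Perm (Fin n), ((Equiv.Perm.sign σ : ℤ) : R) * ∏ i, x i ^ (σ i : ℕ) := by
  rw [← prod_Ioi_eq_prod_ite (fun i j => x j - x i), ← Matrix.det_vandermonde,
    ← Matrix.det_transpose, Matrix.det_apply']
  rfl

theorem single_pow_prod {n : ℕ} {M : Type*} [AddCommMonoid M] (α : Fin n → M) (e : Fin n → ℕ) :
    ∏ i, (AddMonoidAlgebra.single (α i) (1 : ℤ)) ^ e i =
      AddMonoidAlgebra.single (∑ i, e i • α i) 1 := by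
  simp [AddMonoidAlgebra.single_pow]

/-- The identity `∏_{i<j} (X_j - X_i) = ∏_{i<j} (z_j - z_i) ∏_{i<j} (y_j - y_i) ∏_{i,j} (y_j - z_i)`
for the variables `X = (z, y)`, with all three Vandermonde determinants expanded. -/
theorem vandermonde_append (r m : ℕ) :
    (∑ σ : Equiv.Perm (Fin (r + m)), AddMonoidAlgebra.single
      (Fin.append (fun i => (σ (Fin.castAdd m i) : ℤ)) fun j => (σ (Fin.natAdd r j) : ℤ))
      (Equiv.Perm.sign σ : ℤ)) =
    ∑ τ : Equiv.Perm (Fin r), ∑ τ' : Equiv.Perm (Fin m), ∑ S : Fin r → Fin m → Bool,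
      AddMonoidAlgebra.single (Fin.append (fun i => (τ i : ℤ) + rowSum S i)
        fun j => (τ' j : ℤ) + (r - colSum S j))
        ((Equiv.Perm.sign τ : ℤ) * (Equiv.Perm.sign τ' : ℤ) * (-1) ^ weight S) := by
  have hp {n : ℕ} (c : ℤ) (w : Fin n → ℤ) : ((c : ℤ) : AddMonoidAlgebra ℤ (Fin n → ℤ)) *
      AddMonoidAlgebra.single w 1 = AddMonoidAlgebra.single w c := by
    rw [← zsmul_eq_mul, AddMonoidAlgebra.smul_single, smul_eq_mul, mul_one]
  have h0 := prod_sub_eq_sum_perm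
    (fun i : Fin (r + m) => AddMonoidAlgebra.single (Pi.single i (1 : ℤ)) (1 : ℤ))
  rw [prod_lt_append, prod_sub_eq_sum_perm
    (fun i : Fin r => AddMonoidAlgebra.single
      (Pi.single (Fin.castAdd m i) (1 : ℤ) : Fin (r + m) → ℤ) (1 : ℤ)),
    prod_sub_eq_sum_perm
    (fun i : Fin m => AddMonoidAlgebra.single
      (Pi.single (Fin.natAdd r i) (1 : ℤ) : Fin (r + m) → ℤ) (1 : ℤ))] at h0
  simp only [single_pow_prod, hp] at h0
  have h1 : ∀ σ : Equiv.Perm (Fin (r + m)), ∑ i, (σ i : ℕ) • (Pi.single i (1 : ℤ) : Fin (r + m) → ℤ)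
      = Fin.append (fun i => (σ (Fin.castAdd m i) : ℤ)) fun j => (σ (Fin.natAdd r j) : ℤ) := by
    intro σ
    ext k
    rw [Fin.append_castAdd_natAdd (f := fun i => (σ i : ℤ))]
    simp [Finset.sum_apply, Pi.single_apply]
  have h2 : ∀ τ : Equiv.Perm (Fin r),
      ∑ i, (τ i : ℕ) • (Pi.single (Fin.castAdd m i) (1 : ℤ) : Fin (r + m) → ℤ) =
        appendZero r m fun i => (τ i : ℤ) := by
    intro τ
    ext k
    refine Fin.addCases (fun k => ?_) (fun k => ?_) k
    · simp [Finset.sum_apply, Pi.single_apply, appendZero]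
    · have h3 : ∀ i : Fin r, Fin.natAdd r k ≠ Fin.castAdd m i := fun j => by
        rw [Ne, Fin.ext_iff]; simp; omega
      simp [Finset.sum_apply, appendZero, h3]
  have h2' : ∀ τ : Equiv.Perm (Fin m),
      ∑ i, (τ i : ℕ) • (Pi.single (Fin.natAdd r i) (1 : ℤ) : Fin (r + m) → ℤ) =
        zeroAppend r m fun i => (τ i : ℤ) := by
    intro τ
    ext k
    refine Fin.addCases (fun k => ?_) (fun k => ?_) k
    · have h3 : ∀ i : Fin m, Fin.castAdd m k ≠ Fin.natAdd r i := fun j => by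
        rw [Ne, Fin.ext_iff]; simp; omega
      simp [Finset.sum_apply, zeroAppend, h3]
    · simp [Finset.sum_apply, Pi.single_apply, zeroAppend]
  have h4 : ∀ (i : Fin r) (j : Fin m),
      (AddMonoidAlgebra.single (Pi.single (Fin.natAdd r j) 1) 1 -
        AddMonoidAlgebra.single (Pi.single (Fin.castAdd m i) 1) 1 :
        AddMonoidAlgebra ℤ (Fin (r + m) → ℤ)) =
      ∑ b : Bool, AddMonoidAlgebra.single (Pi.single (Fin.castAdd m i) (b.toNat : ℤ) +
        Pi.single (Fin.natAdd r j) (1 - b.toNat : ℤ)) ((-1) ^ b.toNat) := by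
    intro i j
    simp [sub_eq_add_neg, add_comm, AddMonoidAlgebra.single_neg]
  have h5 : ∀ S : Fin r → Fin m → Bool,
      ∑ i, ∑ j, (Pi.single (Fin.castAdd m i) ((S i j).toNat : ℤ) +
        Pi.single (Fin.natAdd r j) (1 - (S i j).toNat : ℤ) : Fin (r + m) → ℤ) =
      Fin.append (rowSum S) fun j => r - colSum S j := by
    intro S
    ext k
    refine Fin.addCases (fun k => ?_) (fun k => ?_) k
    · have h3 : ∀ j : Fin m, Fin.castAdd m k ≠ Fin.natAdd r j := fun j => by
        rw [Ne, Fin.ext_iff]; simp; omega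
      simp [Finset.sum_apply, Pi.single_apply, rowSum, h3]
    · have h3 : ∀ j : Fin r, Fin.natAdd r k ≠ Fin.castAdd m j := fun j => by
        rw [Ne, Fin.ext_iff]; simp; omega
      simp [Finset.sum_apply, Pi.single_apply, colSum, h3, Finset.sum_sub_distrib]
  have h6 : ∀ S : Fin r → Fin m → Bool, ∏ i, ∏ j, (-1 : ℤ) ^ (S i j).toNat = (-1) ^ weight S := by
    intro S; simp only [Finset.prod_pow_eq_pow_sum, weight]
  simp only [h1, h2, h2', h4, prod_prod_sum_single, h5, h6] at h0
  rw [← h0, Finset.sum_mul_sum, Finset.sum_mul]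
  refine Finset.sum_congr rfl fun τ _ => ?_
  rw [Finset.sum_mul]
  refine Finset.sum_congr rfl fun τ' _ => ?_
  rw [Finset.mul_sum]
  refine Finset.sum_congr rfl fun S _ => ?_
  rw [AddMonoidAlgebra.single_mul_single, AddMonoidAlgebra.single_mul_single,
    appendZero_add_zeroAppend]
  congr 1
  ext k
  refine Fin.addCases (fun k => ?_) (fun k => ?_) k <;> simp

section Antisymm
variable {E : Type*} [AddCommGroup E] [IsAddTorsionFree E]

theorem IsAntisymm.eq_zero {L : ℕ} {H : (Fin L → ℤ) → E} (hH : IsAntisymm H)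
    {w : Fin L → ℤ} {i j : Fin L} (hij : i ≠ j) (hw : w i = w j) : H w = 0 := by
  have h1 := hH (Equiv.swap i j) w
  have h2 : w ∘ Equiv.swap i j = w := by
    ext k
    simp only [Function.comp_apply, Equiv.swap_apply_def]
    split_ifs with h3 h4
    · rw [h3, hw]
    · rw [h4, hw]
    · rfl
  rw [h2, Equiv.Perm.sign_swap hij] at h1
  exact self_eq_neg.1 (by simpa using h1)

open Classical in
/-- An antisymmetric function is determined by its values on increasing vectors. -/
theorem IsAntisymm.eq_sum_strictMono {L : ℕ} {H : (Fin L → ℤ) → E} (hH : IsAntisymm H)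
    (w : Fin L → ℤ) :
    H w = ∑ τ : Equiv.Perm (Fin L), (Equiv.Perm.sign τ : ℤ) •
      if StrictMono (w ∘ τ) then H (w ∘ τ) else 0 := by
  by_cases hw : Function.Injective w
  · rw [Finset.sum_eq_single (Tuple.sort w)]
    · rw [if_pos ((Tuple.monotone_sort w).strictMono_of_injective
        (hw.comp (Equiv.injective _))), hH, smul_smul]
      norm_cast
      simp
    · intro τ _ hτ
      rw [if_neg, smul_zero]
      intro h1
      have h2 := Tuple.unique_monotone h1.monotone (Tuple.monotone_sort w)
      exact hτ (Equiv.ext fun k => hw (congrFun h2 k))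
    · simp
  · rw [Finset.sum_eq_zero]
    · rw [Function.Injective] at hw
      push Not at hw
      obtain ⟨i, j, h1, h2⟩ := hw
      exact hH.eq_zero h2 h1
    · intro τ _
      rw [if_neg, smul_zero]
      intro h1
      exact hw (by simpa using h1.injective.comp τ.symm.injective)

open Classical in
/-- The expansion of `∏_{i,j} (y_j - z_i)`, times `∏_i z_i^{i-1} ∏_j y_j^{j-1}`, under an
antisymmetric function `H`. By `vandermonde_append` and antisymmetry the exponents that survive are
those of the Vandermonde determinant in `(z, y)`. -/
theorem sum_boolMatrix_eq_sum_perm {r m : ℕ} {H : (Fin r → ℤ) → (Fin m → ℤ) → E}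
    (h1 : ∀ x, IsAntisymm fun w => H w x) (h2 : ∀ w, IsAntisymm (H w)) :
    ∑ S : Fin r → Fin m → Bool, (-1 : ℤ) ^ weight S •
      H (fun i => (i : ℕ) + rowSum S i) (fun j => (j : ℕ) + (r - colSum S j)) =
    ∑ σ : Equiv.Perm (Fin (r + m)) with
      StrictMono (fun i => σ (Fin.castAdd m i)) ∧ StrictMono (fun j => σ (Fin.natAdd r j)),
      (Equiv.Perm.sign σ : ℤ) •
        H (fun i => (σ (Fin.castAdd m i) : ℕ)) (fun j => (σ (Fin.natAdd r j) : ℕ)) := by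
  -- the restriction of `H` to increasing vectors; antisymmetrizing it gives back `H`
  let J (w : Fin r → ℤ) (x : Fin m → ℤ) : E :=
    if StrictMono w ∧ StrictMono x then H w x else 0
  have hJ (w x) : H w x = ∑ τ : Equiv.Perm (Fin r), ∑ τ' : Equiv.Perm (Fin m),
      ((Equiv.Perm.sign τ : ℤ) * (Equiv.Perm.sign τ' : ℤ)) • J (w ∘ τ) (x ∘ τ') := by
    rw [(h1 x).eq_sum_strictMono]
    refine Finset.sum_congr rfl fun τ _ => ?_
    split_ifs with h3
    · rw [(h2 _).eq_sum_strictMono, Finset.smul_sum]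
      refine Finset.sum_congr rfl fun τ' _ => ?_
      rw [smul_smul]
      simp only [J, h3, true_and]
    · simp [J, h3]
  let Ψ : AddMonoidAlgebra ℤ (Fin (r + m) → ℤ) →+ E :=
    { toFun := fun P => Finsupp.linearCombination ℤ (fun w : Fin (r + m) → ℤ =>
        J (fun i => w (Fin.castAdd m i)) (fun j => w (Fin.natAdd r j))) P.coeff
      map_zero' := by simp
      map_add' := fun P Q => by simp }
  have hΨ (w x) (c : ℤ) : Ψ (AddMonoidAlgebra.single (Fin.append w x) c) = c • J w x := by
    simp [Ψ]
  have h3 := congrArg Ψ (vandermonde_append r m)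
  simp only [map_sum, hΨ] at h3
  have h4 : ∀ σ : Equiv.Perm (Fin (r + m)),
      J (fun i => ((σ (Fin.castAdd m i) : ℕ) : ℤ)) (fun j => ((σ (Fin.natAdd r j) : ℕ) : ℤ)) =
      if StrictMono (fun i => σ (Fin.castAdd m i)) ∧ StrictMono (fun j => σ (Fin.natAdd r j)) then
        H (fun i => (σ (Fin.castAdd m i) : ℕ)) (fun j => (σ (Fin.natAdd r j) : ℕ)) else 0 := by
    intro σ
    simp only [J]
    congr 1
    simp [StrictMono]
  simp only [h4, smul_ite, smul_zero] at h3
  rw [Finset.sum_filter, h3]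
  simp only [hJ, Finset.smul_sum]
  rw [Finset.sum_comm]
  refine Finset.sum_congr rfl fun τ _ => ?_
  rw [Finset.sum_comm]
  refine Finset.sum_congr rfl fun τ' _ => ?_
  rw [← sum_boolMatrix_comp (fun S => (_ • J _ _ : E)) τ τ']
  refine Finset.sum_congr rfl fun S _ => ?_
  rw [rowSum_comp, colSum_comp, weight_comp, smul_smul, mul_comm]
  rfl

end Antisymm

/-! ### Shuffles and partitions in a box -/

/-- The permutations of `r + m` letters that are increasing on the first `r` and on the last `m`
letters. -/
def IsShuffle {r m : ℕ} (σ : Equiv.Perm (Fin (r + m))) : Prop :=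
  StrictMono (fun i => σ (Fin.castAdd m i)) ∧ StrictMono (fun j => σ (Fin.natAdd r j))

/-- The partition of a shuffle. Its parts count, for each letter of the first block, the letters of
the second block that are moved before it; the reversal `Fin.rev` makes the parts decrease. -/
def shufflePartition {r m : ℕ} (σ : Equiv.Perm (Fin (r + m))) (i : Fin r) : ℕ :=
  (Finset.univ.filter fun j : Fin m => σ (Fin.natAdd r j) < σ (Fin.castAdd m i.rev)).card

theorem card_shuffle_lt {r m : ℕ} (σ : Equiv.Perm (Fin (r + m))) (k : Fin (r + m)) :
    (Finset.univ.filter fun i : Fin r => σ (Fin.castAdd m i) < σ k).card +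
      (Finset.univ.filter fun j : Fin m => σ (Fin.natAdd r j) < σ k).card = σ k := by
  have h1 := Fin.sum_univ_add fun l : Fin (r + m) => if σ l < σ k then 1 else 0
  rw [Equiv.sum_comp σ fun l => if l < σ k then 1 else 0] at h1
  simp only [← Finset.card_filter] at h1
  rw [← h1, Finset.filter_gt_eq_Iio, Fin.card_Iio]

theorem card_castAdd_lt {r m : ℕ} {σ : Equiv.Perm (Fin (r + m))} (hσ : IsShuffle σ)
    (i : Fin r) : (Finset.univ.filter fun i' : Fin r =>
      σ (Fin.castAdd m i') < σ (Fin.castAdd m i)).card = i := by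
  simp only [hσ.1.lt_iff_lt]
  rw [Finset.filter_gt_eq_Iio, Fin.card_Iio]

theorem card_natAdd_lt {r m : ℕ} {σ : Equiv.Perm (Fin (r + m))} (hσ : IsShuffle σ)
    (j : Fin m) : (Finset.univ.filter fun j' : Fin m =>
      σ (Fin.natAdd r j') < σ (Fin.natAdd r j)).card = j := by
  simp only [hσ.2.lt_iff_lt]
  rw [Finset.filter_gt_eq_Iio, Fin.card_Iio]

theorem shuffle_castAdd {r m : ℕ} {σ : Equiv.Perm (Fin (r + m))} (hσ : IsShuffle σ)
    (i : Fin r) : (σ (Fin.castAdd m i) : ℕ) = i + shufflePartition σ i.rev := by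
  rw [← card_shuffle_lt, card_castAdd_lt hσ, shufflePartition, Fin.rev_rev]

theorem lt_shufflePartition_iff {r m : ℕ} {σ : Equiv.Perm (Fin (r + m))} (hσ : IsShuffle σ)
    (i : Fin r) (j : Fin m) :
    (j : ℕ) < shufflePartition σ i ↔ σ (Fin.natAdd r j) < σ (Fin.castAdd m i.rev) := by
  constructor
  · intro h
    by_contra h1
    refine absurd h (not_lt.2 ?_)
    rw [shufflePartition, ← Fin.card_Iio j]
    refine Finset.card_le_card fun j' hj' => ?_
    rw [Finset.mem_filter] at hj'
    rw [Finset.mem_Iio]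
    exact hσ.2.lt_iff_lt.1 (hj'.2.trans_le (not_lt.1 h1))
  · intro h
    rw [← Nat.add_one_le_iff, ← Fin.card_Iic j, shufflePartition]
    refine Finset.card_le_card fun j' hj' => ?_
    rw [Finset.mem_Iic] at hj'
    exact Finset.mem_filter.2 ⟨Finset.mem_univ _, (hσ.2.monotone hj').trans_lt h⟩

theorem conj_shufflePartition {r m : ℕ} {σ : Equiv.Perm (Fin (r + m))} (hσ : IsShuffle σ)
    (j : Fin m) : conj m (shufflePartition σ) j =
      (Finset.univ.filter fun i : Fin r => σ (Fin.natAdd r j) < σ (Fin.castAdd m i)).card := by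
  rw [conj]
  simp only [lt_shufflePartition_iff hσ]
  exact Finset.card_equiv Fin.revPerm (by simp)

theorem shuffle_natAdd {r m : ℕ} {σ : Equiv.Perm (Fin (r + m))} (hσ : IsShuffle σ)
    (j : Fin m) :
    (σ (Fin.natAdd r j) : ℕ) + conj m (shufflePartition σ) j = j + r := by
  have h1 := card_shuffle_lt σ (Fin.natAdd r j)
  rw [card_natAdd_lt hσ] at h1
  have h2 := Finset.card_filter_add_card_filter_not (s := (Finset.univ : Finset (Fin r)))
    (fun i => σ (Fin.castAdd m i) < σ (Fin.natAdd r j))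
  have h3 : (Finset.univ.filter fun i : Fin r =>
      ¬ σ (Fin.castAdd m i) < σ (Fin.natAdd r j)) = Finset.univ.filter fun i : Fin r =>
      σ (Fin.natAdd r j) < σ (Fin.castAdd m i) := by
    refine Finset.filter_congr fun i _ => ?_
    have : σ (Fin.natAdd r j) ≠ σ (Fin.castAdd m i) := fun h => by
      have := congrArg Fin.val (σ.injective h)
      simp at this
      omega
    rw [not_lt, le_iff_lt_or_eq, or_iff_left this]
  rw [h3, ← conj_shufflePartition hσ, Finset.card_univ, Fintype.card_fin] at h2
  omega

theorem sign_shuffle {r m : ℕ} {σ : Equiv.Perm (Fin (r + m))} (hσ : IsShuffle σ) :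
    Equiv.Perm.sign σ = (-1) ^ ∑ i, shufflePartition σ i := by
  rw [Equiv.Perm.sign_eq_prod_prod_Ioi,
    prod_Ioi_eq_prod_ite (fun i j => if σ i < σ j then (1 : ℤˣ) else -1), prod_lt_append,
    Finset.prod_eq_one, Finset.prod_eq_one, one_mul, one_mul, ← Equiv.sum_comp Fin.revPerm,
    ← Finset.prod_pow_eq_pow_sum]
  · refine Finset.prod_congr rfl fun i _ => ?_
    rw [shufflePartition, Fin.revPerm_apply, Fin.rev_rev, ← Finset.prod_const,
      Finset.prod_filter]
    refine Finset.prod_congr rfl fun j _ => ?_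
    have : σ (Fin.natAdd r j) ≠ σ (Fin.castAdd m i) := fun h => by
      have := congrArg Fin.val (σ.injective h)
      simp at this
      omega
    rcases lt_or_gt_of_ne this with h | h
    · rw [if_neg h.not_gt, if_pos h]
    · rw [if_pos h, if_neg h.not_gt]
  · refine fun i _ => Finset.prod_eq_one fun j _ => ?_
    split_ifs with h1 h2
    · rfl
    · exact absurd (hσ.2 h1) h2
    · rfl
  · refine fun i _ => Finset.prod_eq_one fun j _ => ?_
    split_ifs with h1 h2
    · rfl
    · exact absurd (hσ.1 h1) h2
    · rfl

theorem mem_boxPartitions {r m : ℕ} {μ : Fin r → ℕ} :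
    μ ∈ boxPartitions r m ↔ (∀ i, μ i ≤ m) ∧ Antitone μ := by
  simp [boxPartitions]

theorem shufflePartition_mem {r m : ℕ} {σ : Equiv.Perm (Fin (r + m))} (hσ : IsShuffle σ) :
    shufflePartition σ ∈ boxPartitions r m := by
  rw [mem_boxPartitions]
  refine ⟨fun i => (Finset.card_filter_le _ _).trans (by simp), fun i i' hi => ?_⟩
  refine Finset.card_le_card fun j hj => ?_
  rw [Finset.mem_filter] at hj ⊢
  exact ⟨hj.1, hj.2.trans_le (hσ.1.monotone (Fin.rev_le_rev.2 hi))⟩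

theorem conj_antitone {r : ℕ} (m : ℕ) (μ : Fin r → ℕ) : Antitone (conj m μ) := by
  intro j j' hj
  refine Finset.card_le_card fun i hi => ?_
  rw [Finset.mem_filter] at hi ⊢
  exact ⟨hi.1, (show (j : ℕ) ≤ j' from hj).trans_lt hi.2⟩

theorem conj_le {r m : ℕ} (μ : Fin r → ℕ) (j : Fin m) : conj m μ j ≤ r :=
  (Finset.card_filter_le _ _).trans (by simp)

theorem lt_conj_iff {r m : ℕ} {μ : Fin r → ℕ} (hμ : Antitone μ) (i : Fin r) (j : Fin m) :
    (i : ℕ) < conj m μ j ↔ (j : ℕ) < μ i := by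
  constructor
  · intro h
    by_contra h1
    refine absurd h (not_lt.2 ?_)
    rw [conj, ← Fin.card_Iio i]
    refine Finset.card_le_card fun i' hi' => ?_
    rw [Finset.mem_filter] at hi'
    rw [Finset.mem_Iio]
    by_contra h2
    exact h1 (hi'.2.trans_le (hμ (not_lt.1 h2)))
  · intro h
    rw [← Nat.add_one_le_iff, ← Fin.card_Iic i, conj]
    refine Finset.card_le_card fun i' hi' => ?_
    rw [Finset.mem_Iic] at hi'
    exact Finset.mem_filter.2 ⟨Finset.mem_univ _, h.trans_le (hμ hi')⟩

/-- The numbers `μ_i + r - i` and `r - 1 + j - μ'_j` for `1 ≤ i ≤ r` and `1 ≤ j ≤ m` exhaust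
`0, …, r + m - 1`. -/
theorem exists_shuffle {r m : ℕ} {μ : Fin r → ℕ} (hμ : μ ∈ boxPartitions r m) :
    ∃ σ : Equiv.Perm (Fin (r + m)), IsShuffle σ ∧ shufflePartition σ = μ := by
  obtain ⟨hm, hμ⟩ := mem_boxPartitions.1 hμ
  let f : Fin (r + m) → Fin (r + m) :=
    Fin.append (fun i => ⟨i + μ i.rev, by have := hm i.rev; have := i.2; omega⟩)
      (fun j => ⟨j + r - conj m μ j, by have := j.2; omega⟩)
  have hf1 (i : Fin r) : (f (Fin.castAdd m i) : ℕ) = i + μ i.rev := by simp [f]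
  have hf2 (j : Fin m) : (f (Fin.natAdd r j) : ℕ) = j + r - conj m μ j := by simp [f]
  have hlt (i : Fin r) (j : Fin m) : (i : ℕ) + μ i.rev ≠ j + r - conj m μ j := by
    have h1 := lt_conj_iff hμ i.rev j
    have h2 := conj_le μ j
    have h3 := Fin.val_rev i
    omega
  have hs1 : StrictMono fun i => f (Fin.castAdd m i) := by
    intro i i' hi
    have h1 := hμ (Fin.rev_le_rev.2 hi.le)
    have h2 : (i : ℕ) < i' := hi
    rw [Fin.lt_def, hf1, hf1]
    omega
  have hs2 : StrictMono fun j => f (Fin.natAdd r j) := by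
    intro j j' hj
    have h1 := conj_antitone m μ hj.le
    have h2 : (j : ℕ) < j' := hj
    have h3 := conj_le μ j
    rw [Fin.lt_def, hf2, hf2]
    omega
  have hinj : Function.Injective f := by
    intro k k'
    refine Fin.addCases (fun i => ?_) (fun j => ?_) k <;>
      refine Fin.addCases (fun i' => ?_) (fun j' => ?_) k'
    · intro h; rw [hs1.injective h]
    · intro h; exact absurd (congrArg Fin.val h) (by rw [hf1, hf2]; exact hlt i j')
    · intro h; exact absurd (congrArg Fin.val h) (by rw [hf1, hf2]; exact (hlt i' j).symm)
    · intro h; rw [hs2.injective h]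
  have hσ : IsShuffle (Equiv.ofBijective f (Finite.injective_iff_bijective.1 hinj)) := ⟨hs1, hs2⟩
  refine ⟨_, hσ, funext fun i => ?_⟩
  have h1 := shuffle_castAdd hσ i.rev
  rw [Equiv.ofBijective_apply, hf1, Fin.rev_rev] at h1
  omega

theorem shufflePartition_injOn {r m : ℕ} {σ τ : Equiv.Perm (Fin (r + m))} (hσ : IsShuffle σ)
    (hτ : IsShuffle τ) (h : shufflePartition σ = shufflePartition τ) : σ = τ := by
  ext k
  refine Fin.addCases (fun i => ?_) (fun j => ?_) k
  · rw [shuffle_castAdd hσ, shuffle_castAdd hτ, h]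
  · have h1 := shuffle_natAdd hσ j
    have h2 := shuffle_natAdd hτ j
    rw [h] at h1
    omega

/-- The dual Cauchy identity for `t = 1`, with exponents in increasing order. -/
theorem sum_boolMatrix_eq_sum_boxPartitions {E : Type*} [AddCommGroup E] [IsAddTorsionFree E]
    {r m : ℕ} {H : (Fin r → ℤ) → (Fin m → ℤ) → E}
    (h1 : ∀ x, IsAntisymm fun w => H w x) (h2 : ∀ w, IsAntisymm (H w)) :
    ∑ S : Fin r → Fin m → Bool, (-1 : ℤ) ^ weight S •
      H (fun i => (i : ℕ) + rowSum S i) (fun j => (j : ℕ) + (r - colSum S j)) =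
    ∑ μ ∈ boxPartitions r m, (-1 : ℤ) ^ (∑ i, μ i) •
      H (fun i => (i : ℕ) + μ i.rev) (fun j => (j : ℕ) + (r - conj m μ j)) := by
  rw [sum_boolMatrix_eq_sum_perm h1 h2]
  refine Finset.sum_nbij shufflePartition (fun σ hσ => shufflePartition_mem ?_)
    (fun σ hσ τ hτ h => shufflePartition_injOn ?_ ?_ h) (fun μ hμ => ?_) (fun σ hσ => ?_)
  · exact (Finset.mem_filter.1 hσ).2
  · exact (Finset.mem_filter.1 hσ).2
  · exact (Finset.mem_filter.1 hτ).2
  · obtain ⟨σ, hσ, h⟩ := exists_shuffle hμ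
    exact ⟨σ, Finset.mem_coe.2 (Finset.mem_filter.2 ⟨Finset.mem_univ _, hσ⟩), h⟩
  · have hσ : IsShuffle σ := (Finset.mem_filter.1 hσ).2
    rw [sign_shuffle hσ]
    have h3 : (fun i => ((σ (Fin.castAdd m i) : ℕ) : ℤ)) =
        fun i : Fin r => ((i : ℕ) : ℤ) + (shufflePartition σ i.rev : ℤ) :=
      funext fun i => by rw [shuffle_castAdd hσ]; push_cast; rfl
    have h4 : (fun j => ((σ (Fin.natAdd r j) : ℕ) : ℤ)) =
        fun j : Fin m => ((j : ℕ) : ℤ) + (r - conj m (shufflePartition σ) j) :=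
      funext fun j => by have := shuffle_natAdd hσ j; omega
    rw [h3, h4]
    simp

theorem IsAntisymm.comp_rev {L : ℕ} {E : Type*} [AddCommGroup E] {F : (Fin L → ℤ) → E}
    (hF : IsAntisymm fun w => F fun i => w i + (i : ℕ)) (c : ℤ) :
    IsAntisymm fun w : Fin L → ℤ => F fun i => c + w i.rev + (i : ℕ) := by
  intro σ w
  have h1 := hF (Fin.revPerm * σ * Fin.revPerm) fun i => c + w i.rev
  have h2 : Equiv.Perm.sign (Fin.revPerm * σ * Fin.revPerm : Equiv.Perm (Fin L)) =
      Equiv.Perm.sign σ := by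
    rw [Equiv.Perm.sign_mul, Equiv.Perm.sign_mul, mul_right_comm, Int.units_mul_self, one_mul]
  rw [h2] at h1
  simpa using h1

/-- The dual Cauchy identity `∏_{i,j} (1 - t x_i / y_j) = ∑_μ (-t)^{|μ|} s_μ(x) s_{μ'}(1/y)`, with
both sides multiplied by `x^{(a,…,a)} y^{(b,…,b)}` and evaluated under a function that is
antisymmetric, up to the shift by `ρ`, in each of the two sets of variables. -/
theorem dual_cauchy {K E : Type*} [CommRing K] [AddCommGroup E] [Module K E]
    [IsAddTorsionFree E] (t : K) {r m : ℕ} {F : (Fin r → ℤ) → (Fin m → ℤ) → E}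
    (h1 : ∀ x, IsAntisymm fun w => F (fun i => w i + (i : ℕ)) x)
    (h2 : ∀ w, IsAntisymm fun x => F w (fun j => x j + (j : ℕ))) (a b : ℤ) :
    ∑ S : Fin r → Fin m → Bool, (-t) ^ weight S •
      F (fun i => a + rowSum S i) (fun j => b - colSum S j) =
    ∑ μ ∈ boxPartitions r m, (-t) ^ (∑ i, μ i) •
      F (fun i => a + μ i) (fun j => b - conj m μ j.rev) := by
  -- the powers of `t` are absorbed in `H`, as the sum of the entries of `w` is symmetric in `w`
  let c : ℤ := ∑ i : Fin r, (i : ℤ)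
  let H (w : Fin r → ℤ) (x : Fin m → ℤ) : E := t ^ (∑ i, w i - c).toNat •
    F (fun i => (a - (r - 1)) + w i.rev + (i : ℕ)) (fun j => (b - r - (m - 1)) + x j.rev + (j : ℕ))
  have h3 := sum_boolMatrix_eq_sum_boxPartitions (H := H)
    (fun x σ w => by
      have := IsAntisymm.comp_rev (F := fun w =>
        F w fun j => (b - r - (m - 1)) + x j.rev + (j : ℕ)) (h1 _) (a - (r - 1)) σ w
      simp only [H, Function.comp_apply] at this ⊢
      rw [this, Equiv.sum_comp σ w, smul_comm])
    (fun w σ x => by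
      have := (h2 (fun i => (a - (r - 1)) + w i.rev + (i : ℕ))).comp_rev (b - r - (m - 1)) σ x
      simp only [H, Function.comp_apply] at this ⊢
      rw [this, smul_comm])
  have hrev {L : ℕ} (i : Fin L) : ((i.rev : ℕ) : ℤ) = L - 1 - (i : ℕ) := by
    rw [Fin.val_rev]; have := i.2; omega
  have hneg (k : ℕ) (x : E) : (-t) ^ k • x = (-1 : ℤ) ^ k • t ^ k • x := by
    rw [neg_pow, mul_smul, ← Int.cast_smul_eq_zsmul K]
    push_cast
    rfl
  calc _ = ∑ S : Fin r → Fin m → Bool, (-1 : ℤ) ^ weight S •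
        H (fun i => (i : ℕ) + rowSum S i) (fun j => (j : ℕ) + (r - colSum S j)) := by
        rw [← sum_boolMatrix_comp _ Fin.revPerm Fin.revPerm]
        refine Finset.sum_congr rfl fun S _ => ?_
        rw [weight_comp, rowSum_comp, colSum_comp, hneg]
        simp only [H, Finset.sum_add_distrib, sum_rowSum, c, add_sub_cancel_left, Int.toNat_natCast]
        congr 3 <;> ext k <;> simp <;> ring
    _ = _ := by
        rw [h3]
        refine Finset.sum_congr rfl fun μ _ => ?_
        have h4 : ∑ i : Fin r, ((i : ℕ) + (μ i.rev : ℤ)) - c = ((∑ i, μ i : ℕ) : ℤ) := by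
          rw [Finset.sum_add_distrib, add_sub_cancel_left, ← Equiv.sum_comp Fin.revPerm]
          simp
        rw [hneg]
        simp only [H, h4, Int.toNat_natCast]
        congr 3 <;> ext k <;> simp only [hrev, Fin.rev_rev] <;> ring

/-! ### Raising operators next to a rectangle -/

section Pieri
variable {E : Type*} [AddCommGroup E]

/-- The function `v ↦ ∑_T F(v + T)`, where `T` runs over the `0`-`1` vectors with sum `l`; this is
multiplication by the elementary symmetric function `e_l`. -/
def elemMul {m : ℕ} (l : ℕ) (F : (Fin m → ℤ) → E) (v : Fin m → ℤ) : E :=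
  ∑ T : Fin m → Bool with ∑ i, (T i).toNat = l, F fun i => v i + ((T i).toNat : ℤ)

theorem isAntisymm_elemMul {m : ℕ} {F : (Fin m → ℤ) → E}
    (hF : IsAntisymm fun w => F fun i => w i + (i : ℕ)) (l : ℕ) :
    IsAntisymm fun w : Fin m → ℤ => elemMul l F fun i => w i + (i : ℕ) := by
  intro σ w
  simp only [elemMul, Finset.smul_sum]
  refine (Finset.sum_equiv (Equiv.arrowCongr σ.symm (Equiv.refl Bool)) (fun T => ?_)
    fun T _ => ?_).symm
  · simp only [Finset.mem_filter, Finset.mem_univ, true_and]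
    rw [← Equiv.sum_comp σ]
    rfl
  · have h1 := hF σ fun i => w i + ((T i).toNat : ℤ)
    simp only [Function.comp_apply] at h1
    simp only [add_right_comm _ _ (((T _).toNat : ℤ))]
    rw [← h1]
    congr 1
    ext i
    simp [add_right_comm]

variable [IsAddTorsionFree E]

/-- Pieri's rule: a `0`-`1` vector `T` contributes to `e_l s_μ` only if `μ + T` is a partition. -/
theorem antisymm_add_eq_zero {m : ℕ} {F : (Fin m → ℤ) → E}
    (hF : IsAntisymm fun w => F fun i => w i + (i : ℕ)) {a : ℤ} {μ : Fin m → ℕ} (hμ : Antitone μ)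
    {T : Fin m → Bool} (hT : ¬ Antitone fun i => μ i + (T i).toNat) :
    F (fun i => a + μ i + ((T i).toNat : ℤ)) = 0 := by
  cases m with
  | zero => exact absurd (fun i => i.elim0) hT
  | succ m =>
    rw [Fin.antitone_iff_succ_le] at hT
    push Not at hT
    obtain ⟨i, hi⟩ := hT
    have h1 : μ i.succ ≤ μ i.castSucc := hμ i.castSucc_lt_succ.le
    have h2 := Bool.toNat_le (T i.succ)
    have h3 := hF.eq_zero (w := fun i => a + μ i + ((T i).toNat : ℤ) - (i : ℕ))
      i.castSucc_lt_succ.ne (by simp only [Fin.val_castSucc, Fin.val_succ]; omega)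
    simpa using h3

/-- The function `F` is antisymmetric and vanishes at `(a,…,a) + μ` for all partitions `μ ≠ 0` with
parts at most `k`. -/
structure VanishesNear {m : ℕ} (F : (Fin m → ℤ) → E) (a : ℤ) (k : ℕ) : Prop where
  antisymm : IsAntisymm fun w => F fun i => w i + (i : ℕ)
  eq_zero : ∀ μ : Fin m → ℕ, Antitone μ → μ ≠ 0 → (∀ i, μ i ≤ k) → F (fun i => a + μ i) = 0

theorem VanishesNear.add_eq_zero {m : ℕ} {F : (Fin m → ℤ) → E} {a : ℤ} {k : ℕ}
    (hF : VanishesNear F a (k + 1)) {μ : Fin m → ℕ} (hμ : Antitone μ) (hk : ∀ i, μ i ≤ k)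
    {T : Fin m → Bool} (hT : (fun i => μ i + (T i).toNat) ≠ 0) :
    F (fun i => a + μ i + ((T i).toNat : ℤ)) = 0 := by
  by_cases h : Antitone fun i => μ i + (T i).toNat
  · simpa [add_assoc] using hF.eq_zero _ h hT fun i => by
      have := hk i; have := Bool.toNat_le (T i); omega
  · exact antisymm_add_eq_zero hF.antisymm hμ h

theorem VanishesNear.elemMul {m : ℕ} {F : (Fin m → ℤ) → E} {a : ℤ} {k : ℕ}
    (hF : VanishesNear F a (k + 1)) (l : ℕ) : VanishesNear (elemMul l F) a k where
  antisymm := isAntisymm_elemMul hF.antisymm l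
  eq_zero μ hμ h0 hk := by
    refine Finset.sum_eq_zero fun T _ => hF.add_eq_zero hμ hk fun h1 => h0 ?_
    ext i
    have := congrFun h1 i
    simp only [Pi.zero_apply] at this ⊢
    omega

/-- The expansion of a product of `n` polynomials `∏_i (1 + c_k x_i)` reduces to its constant term
under a function that vanishes near `(a,…,a)`. The coefficients `c_k`, which need not be scalars,
enter through the function `W` of the column sums. -/
theorem VanishesNear.sum_boolMatrix {E' : Type*} [AddCommMonoid E'] {m n : ℕ}
    {F : (Fin m → ℤ) → E} {a : ℤ} (hF : VanishesNear F a n) (W : (Fin n → ℤ) → E →+ E') :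
    ∑ S : Fin m → Fin n → Bool, W (colSum S) (F fun i => a + rowSum S i) =
      W 0 (F fun _ => a) := by
  rw [← Equiv.sum_comp (Equiv.piComm fun (_ : Fin n) (_ : Fin m) => Bool)]
  change ∑ S : Fin n → Fin m → Bool, W (rowSum S) (F fun i => a + colSum S i) = _
  induction n generalizing F with
  | zero =>
    rw [Fintype.sum_unique]
    congr 2
    · exact Subsingleton.elim _ _
    · simp [colSum]
  | succ n ih =>
    have h1 : ∀ (T : Fin m → Bool) (S : Fin n → Fin m → Bool),
        rowSum (Fin.cons T S : Fin (n + 1) → Fin m → Bool) =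
          Fin.cons ((∑ i, (T i).toNat : ℕ) : ℤ) (rowSum S) := by
      intro T S
      ext i
      refine Fin.cases ?_ (fun i => ?_) i <;> simp [rowSum]
    have h2 : ∀ (T : Fin m → Bool) (S : Fin n → Fin m → Bool) (i : Fin m),
        a + colSum (Fin.cons T S : Fin (n + 1) → Fin m → Bool) i =
          a + colSum S i + ((T i).toNat : ℤ) := by
      intro T S i
      rw [colSum, Fin.sum_univ_succ]
      simp [colSum]
      ring
    have hz : (Fin.cons 0 0 : Fin (n + 1) → ℤ) = 0 := by
      ext i
      refine Fin.cases ?_ (fun i => ?_) i <;> simp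
    rw [← Equiv.sum_comp (Fin.consEquiv fun _ => Fin m → Bool), Fintype.sum_prod_type]
    simp only [Fin.consEquiv, Equiv.coe_fn_mk, h1, h2]
    -- the terms are grouped by the sum `l` of the entries of the first column
    calc _ = ∑ T : Fin m → Bool, ∑ l ∈ Finset.range (m + 1),
          if ∑ i, (T i).toNat = l then ∑ S : Fin n → Fin m → Bool,
            W (Fin.cons (l : ℤ) (rowSum S))
              (F fun i => a + colSum S i + ((T i).toNat : ℤ)) else 0 := by
          refine Finset.sum_congr rfl fun T _ => ?_
          rw [Finset.sum_ite_eq, if_pos]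
          have : ∑ i, (T i).toNat ≤ ∑ _i : Fin m, 1 :=
            Finset.sum_le_sum fun i _ => Bool.toNat_le (T i)
          rw [Finset.mem_range]
          simp at this
          omega
      _ = ∑ l ∈ Finset.range (m + 1), ∑ S : Fin n → Fin m → Bool,
            W (Fin.cons (l : ℤ) (rowSum S)) (SymFn.elemMul l F fun i => a + colSum S i) := by
          rw [Finset.sum_comm]
          refine Finset.sum_congr rfl fun l _ => ?_
          rw [← Finset.sum_filter, Finset.sum_comm]
          refine Finset.sum_congr rfl fun S _ => ?_
          rw [SymFn.elemMul, map_sum]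
      _ = ∑ l ∈ Finset.range (m + 1),
            W (Fin.cons (l : ℤ) 0) (SymFn.elemMul l F fun _ => a) :=
          Finset.sum_congr rfl fun l _ => ih (hF.elemMul l) fun c => W (Fin.cons (l : ℤ) c)
      _ = W 0 (F fun _ => a) := by
          have h3 : ∀ T : Fin m → Bool, T ≠ (fun _ => false) →
              F (fun i => a + ((T i).toNat : ℤ)) = 0 := by
            intro T hT
            have := hF.add_eq_zero (μ := 0) (T := T) antitone_const (fun _ => Nat.zero_le _)
              fun h => hT (funext fun i => by simpa using congrFun h i)
            simpa using this
          rw [Finset.sum_eq_single 0]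
          · rw [Nat.cast_zero, hz, SymFn.elemMul, Finset.sum_eq_single fun _ => false]
            · simp
            · exact fun T _ hT => h3 T hT
            · simp
          · intro l _ hl
            rw [SymFn.elemMul, Finset.sum_eq_zero, map_zero]
            intro T hT
            refine h3 T ?_
            rintro rfl
            simp at hT
            exact hl hT.symm
          · simp

end Pieri

section Blocks
variable {E : Type*} [AddCommGroup E] {p q : ℕ} {F : (Fin (p + q) → ℤ) → E}

theorem IsAntisymm.append_left (hF : IsAntisymm fun w => F fun i => w i + (i : ℕ))
    (v : Fin q → ℤ) :
    IsAntisymm fun u : Fin p → ℤ => F (Fin.append (fun i => u i + (i : ℕ)) v) := by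
  intro σ u
  have h1 := hF (finSumFinEquiv.permCongr (Equiv.Perm.sumCongr σ 1))
    (Fin.append u fun j => v j - (p + (j : ℕ)))
  rw [Equiv.Perm.sign_permCongr, Equiv.Perm.sign_sumCongr, Equiv.Perm.sign_one, mul_one] at h1
  convert h1 using 2
  · refine congrArg F (funext fun k => ?_)
    refine Fin.addCases (fun k => ?_) (fun k => ?_) k <;> simp [Equiv.permCongr_apply]
  · refine congrArg F (funext fun k => ?_)
    refine Fin.addCases (fun k => ?_) (fun k => ?_) k <;> simp

theorem IsAntisymm.append_right (hF : IsAntisymm fun w => F fun i => w i + (i : ℕ))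
    (u : Fin p → ℤ) : IsAntisymm fun v : Fin q → ℤ => F (Fin.append u fun j => v j + (j : ℕ)) := by
  intro σ v
  have h1 := hF (finSumFinEquiv.permCongr (Equiv.Perm.sumCongr 1 σ))
    (Fin.append (fun i => u i - (i : ℕ)) fun j => v j - p)
  rw [Equiv.Perm.sign_permCongr, Equiv.Perm.sign_sumCongr, Equiv.Perm.sign_one, one_mul] at h1
  convert h1 using 2
  · refine congrArg F (funext fun k => ?_)
    refine Fin.addCases (fun k => ?_) (fun k => ?_) k <;> simp [Equiv.permCongr_apply]
    ring
  · refine congrArg F (funext fun k => ?_)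
    refine Fin.addCases (fun k => ?_) (fun k => ?_) k <;> simp
    ring

/-- Straightening: in `(a^r, a^m + μ) + ρ` with `0 < μ_1 ≤ r`, the entry of `a + μ_1` agrees with
that of the `(r + 1 - μ_1)`-th `a`. -/
theorem IsAntisymm.vanishesNear [IsAddTorsionFree E]
    (hF : IsAntisymm fun w => F fun i => w i + (i : ℕ)) (a : ℤ) {k : ℕ} (hk : k ≤ p) :
    VanishesNear (fun v : Fin q → ℤ => F (Fin.append (fun _ => a) v)) a k where
  antisymm := hF.append_right _
  eq_zero μ hμ h0 hμk := by
    cases q with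
    | zero => exact absurd (Subsingleton.elim _ _) h0
    | succ q =>
      have h1 : 0 < μ 0 := by
        by_contra h1
        refine h0 (funext fun i => ?_)
        have := hμ (Fin.zero_le i)
        simp only [Pi.zero_apply]
        omega
      have h2 := hμk 0
      have h3 := hF.eq_zero (w := fun i => Fin.append (fun _ => a) (fun i => a + (μ i : ℤ)) i -
          ((i : ℕ) : ℤ)) (i := Fin.castAdd (q + 1) ⟨p - μ 0, by omega⟩) (j := Fin.natAdd p 0)
        (by rw [Ne, Fin.ext_iff]; simp; omega)
        (by
          simp only [Fin.append_left, Fin.append_right, Fin.val_castAdd, Fin.val_natAdd]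
          push_cast [Nat.cast_sub (show μ 0 ≤ p by omega)]
          simp only [Fin.val_zero, Nat.cast_zero]
          ring)
      simpa using h3

end Blocks

theorem isAddTorsionFree_of_charZero (K : Type*) {E : Type*} [Field K] [CharZero K]
    [AddCommGroup E] [Module K E] : IsAddTorsionFree E where
  nsmul_right_injective n hn x y h := by
    dsimp only at h
    rw [← Nat.cast_smul_eq_nsmul K, ← Nat.cast_smul_eq_nsmul K] at h
    exact smul_right_injective E (Nat.cast_ne_zero.2 hn) h

section Rectangle
variable {K : Type*} [Field K]

/-- For a vector `(u, v, w)` of three blocks, both sides are obtained from `B_u B_v B_w` by the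
factors `1 - t e_{ij}` with `i` in `u` and `j` in `v` and those with `i` in `v` and `j` in `w`. -/
theorem sum_Bvec_append_comm (t : K) {p q s : ℕ} (u : Fin p → ℤ) (v : Fin q → ℤ)
    (w : Fin s → ℤ) :
    ∑ S : Fin q → Fin s → Bool, (-t) ^ weight S •
        (Bvec t (Fin.append u (v + rowSum S)) * Bvec t (w - colSum S)) =
      ∑ S : Fin p → Fin q → Bool, (-t) ^ weight S •
        (Bvec t (u + rowSum S) * Bvec t (Fin.append (v - colSum S) w)) := by
  simp only [Bvec_append, Finset.sum_mul, Finset.mul_sum, Finset.smul_sum]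
  rw [Finset.sum_comm]
  refine Finset.sum_congr rfl fun S _ => Finset.sum_congr rfl fun S' _ => ?_
  rw [smul_mul_assoc, mul_smul_comm, smul_comm, mul_assoc, add_sub_right_comm]

/-- With rectangular `(a^r, a^m)` and `n ≤ r`, the raising operators between the block `a^m` and a
vector of length `n` have no effect. -/
theorem sum_Bvec_append_rectangle [CharZero K] (t : K) (a : ℤ) {r m n : ℕ} (hn : n ≤ r)
    (ν : Fin n → ℤ) :
    ∑ S : Fin m → Fin n → Bool, (-t) ^ weight S •
        (Bvec t (Fin.append (fun _ : Fin r => a) ((fun _ => a) + rowSum S)) *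
          Bvec t (ν - colSum S)) =
      Bvec t (fun _ : Fin (r + m) => a) * Bvec t ν := by
  have := isAddTorsionFree_of_charZero K (E := Module.End K (Lam K))
  have h1 := ((isAntisymm_Bvec t (r + m)).vanishesNear (F := fun v => Bvec t v) a hn).sum_boolMatrix
    fun c => (AddMonoidHom.mulRight (Bvec t (ν - c))).comp
      (DistribSMul.toAddMonoidHom (Module.End K (Lam K)) ((-t) ^ (∑ j, c j).toNat))
  have h2 : ∀ S : Fin m → Fin n → Bool, (∑ j, colSum S j).toNat = weight S := by
    intro S
    have : ∑ j, colSum S j = ∑ i, rowSum S i := Finset.sum_comm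
    rw [this, sum_rowSum, Int.toNat_natCast]
  have h3 : Fin.append (fun _ : Fin r => a) (fun _ : Fin m => a) = fun _ => a := by
    ext k
    refine Fin.addCases (fun k => ?_) (fun k => ?_) k <;> simp
  simp only [AddMonoidHom.comp_apply, AddMonoidHom.mulRight_apply, DistribSMul.toAddMonoidHom_apply,
    h2, h3, smul_mul_assoc, Pi.zero_apply, Finset.sum_const_zero, Int.toNat_zero, pow_zero,
    one_smul, sub_zero] at h1
  exact h1

end Rectangle

end SymFn

end

theorem theorem1 {K : Type*} [Field K] [CharZero K] (t : K) (a r m n : ℕ) (hn : n ≤ r)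
    (ν : Fin n → ℕ) (hν : Antitone ν) :
    SymFn.Bvec t (fun _ : Fin (r + m) => (a : ℤ)) * SymFn.Bvec t (fun i => (ν i : ℤ)) =
      ∑ μ ∈ SymFn.boxPartitions r m,
        (-t) ^ (∑ i, μ i) •
          (SymFn.Bvec t (fun i => (a : ℤ) + (μ i : ℤ)) *
            SymFn.Bvec t (Fin.append (SymFn.rectSubConj a m μ) (fun i => (ν i : ℤ)))) := by
  have := SymFn.isAddTorsionFree_of_charZero K (E := Module.End K (SymFn.Lam K))
  rw [← SymFn.sum_Bvec_append_rectangle t a hn, SymFn.sum_Bvec_append_comm]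
  refine SymFn.dual_cauchy t
    (F := fun u v => SymFn.Bvec t u * SymFn.Bvec t (Fin.append v fun i => (ν i : ℤ)))
    (fun x σ w => ?_) (fun w σ x => ?_) a a
  · have h1 := SymFn.isAntisymm_Bvec t r σ w
    dsimp only at h1 ⊢
    rw [h1, smul_mul_assoc]
  · have h1 := (SymFn.isAntisymm_Bvec t (m + n)).append_left (F := fun v => SymFn.Bvec t v)
      (fun i => (ν i : ℤ)) σ x
    dsimp only at h1 ⊢
    rw [h1, mul_smul_comm]
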